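/- Let $G$ be a connected simple complex algebraic group with (simple) Lie algebra $\mathfrak g$, let $\mathfrak h\subset\mathfrak g$ be a Cartan subalgebra with root space decomposition $\mathfrak g=\mathfrak h\oplus\bigoplus_{\alpha\in\Phi}\mathfrak g_\alpha$, and let $\Phi_+\subset\Phi$ be a system of positive roots. A coweight of $G$ is a cocharacter $\mathbb G_m\to G$ of the maximal torus with Lie algebra $\mathfrak h$, identified with its derivative in $\mathfrak h$; for a coweight $\lambda$ let $t^\lambda\in G(\mathbb C[t,t^{-1}])$ be the corresponding element, and call $\lambda$ dominant if $\alpha(\lambda)\ge 0$ for all $\alpha\in\Phi_+$. Let $t$ be the coordinate of $\mathbb A^1=\mathbb P^1\setminus\{\infty\}$. The (right) $G$-bundle on $\mathbb P^1$ defined by a coweight $\mu$ is obtained by gluing the trivial $G$-bundles on $\mathbb A^1$ and on $\mathbb A^1_\infty=\mathbb P^1\setminus\{0\}$ along $\mathbb A^1\setminus\{0\}$, a point $(y,b)$ of the first being identified with $(y,t(y)^\mu b)$ in the second; in particular it carries a canonical trivialization $\gamma$ on $\mathbb A^1$. For $z\in\mathbb A^1$, a nonzero tangent vector $v\in T_z\mathbb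 A^1$ and $h\in G(\mathbb C[t,t^{-1}])$, the Hecke modification of this bundle with respect to $((z,v),h)$ is the $G$-bundle that agrees with it on $\mathbb P^1\setminus\{z\}$ and for which $\gamma\cdot h(t-z)$ is a trivialization near $z$. Let $\lambda$ and $\mu$ be dominant coweights of $G$, let $\alpha\in\Phi_+$ be a positive root with coroot $\alpha^\vee\in\mathfrak h$, let $j$ be an integer with $0\le j<\alpha(\lambda)$, and let $0\ne x\in\mathfrak g_\alpha$. Then $\nu=\mu+\lambda-(j+\alpha(\mu))\alpha^\vee$ is a coweight of $G$, and for every $z\in\mathbb A^1$ and every $0\neq v\in T_z\mathbb A^1$ the Hecke modification of the $G$-bundle defined by $\mu$ with respect to $((z,v),\exp(xt^j)t^\lambda)$ is isomorphic to the $G$-bundle defined by $\nu$. In particular, its isomorphism class does not depend on $(z,v)$. -/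

import Mathlib

open scoped LaurentPolynomial Polynomial TensorProduct ComplexOrder
open Coalgebra WithConv

universe u

noncomputable section

namespace HeckeP1

/-! ### The projective line

The closed points of `ℙ¹` are `OnePoint ℂ`, with the Zariski topology (the nonempty open sets are
the cofinite ones); the field of rational functions is `ℂ(t) = RatFunc ℂ`. -/

/-- A nonempty Zariski open subset of `ℙ¹`. -/
@[ext]
structure ZOpen where
  carrier : Set (OnePoint ℂ)
  finite_compl : carrierᶜ.Finite

namespace ZOpen

instance : Membership (OnePoint ℂ) ZOpen := ⟨fun U x => x ∈ U.carrier⟩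

instance : LE ZOpen := ⟨fun U V => ∀ x, x ∈ U → x ∈ V⟩

theorem le_refl (U : ZOpen) : U ≤ U := fun _ h => h

theorem le_trans {U V W : ZOpen} (h : U ≤ V) (h' : V ≤ W) : U ≤ W := fun x hx => h' x (h x hx)

theorem nonempty (U : ZOpen) : ∃ x, x ∈ U := by
  by_contra hcon
  push Not at hcon
  have : U.carrierᶜ = Set.univ := Set.eq_univ_of_forall hcon
  exact Set.infinite_univ (this ▸ U.finite_compl)

/-- The intersection of two nonempty open sets. -/
def inter (U V : ZOpen) : ZOpen where
  carrier := U.carrier ∩ V.carrier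
  finite_compl := by
    rw [Set.compl_inter]; exact U.finite_compl.union V.finite_compl

theorem inter_le_left (U V : ZOpen) : U.inter V ≤ U := fun _ h => h.1

theorem inter_le_right (U V : ZOpen) : U.inter V ≤ V := fun _ h => h.2

/-- The open set `U ∖ {z}`. -/
def erase (U : ZOpen) (z : OnePoint ℂ) : ZOpen where
  carrier := U.carrier \ {z}
  finite_compl := by
    rw [Set.sdiff_eq, Set.compl_inter, compl_compl]
    exact U.finite_compl.union (Set.finite_singleton z)

theorem erase_le (U : ZOpen) (z : OnePoint ℂ) : U.erase z ≤ U := fun _ h => h.1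

theorem erase_mono {U V : ZOpen} (h : U ≤ V) (z : OnePoint ℂ) : U.erase z ≤ V.erase z :=
  fun x hx => ⟨h x hx.1, hx.2⟩

theorem inter_mono {U U' V V' : ZOpen} (h : U ≤ U') (h' : V ≤ V') : U.inter V ≤ U'.inter V' :=
  fun x hx => ⟨h x hx.1, h' x hx.2⟩

theorem inter_comm_le (V W : ZOpen) : W.inter V ≤ V.inter W := fun _ hx => ⟨hx.2, hx.1⟩

/-- `ℙ¹` itself. -/
def univ : ZOpen := ⟨Set.univ, by simp⟩

/-- `𝔸¹ = ℙ¹ ∖ {∞}`. -/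
def affine : ZOpen := univ.erase OnePoint.infty

/-- `𝔸¹_∞ = ℙ¹ ∖ {0}`. -/
def affineInfty : ZOpen := univ.erase ((0 : ℂ) : OnePoint ℂ)

theorem coe_mem_affine (z : ℂ) : (z : OnePoint ℂ) ∈ affine :=
  ⟨trivial, OnePoint.coe_ne_infty z⟩

theorem cover_affine (x : OnePoint ℂ) : x ∈ affineInfty ∨ x ∈ affine := by
  by_cases h : x = OnePoint.infty
  · left
    exact ⟨trivial, by simp [h]⟩
  · right
    exact ⟨trivial, h⟩

end ZOpen

/-- The local ring `𝒪_z ⊆ ℂ(t)` of `ℙ¹` at a finite point `z`. -/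
def localRingFinite (z : ℂ) : Subalgebra ℂ (RatFunc ℂ) where
  carrier := {f | ∃ p q : ℂ[X], q.eval z ≠ 0 ∧
    f = algebraMap ℂ[X] (RatFunc ℂ) p / algebraMap ℂ[X] (RatFunc ℂ) q}
  mul_mem' := by
    rintro _ _ ⟨p, q, hq, rfl⟩ ⟨p', q', hq', rfl⟩
    exact ⟨p * p', q * q', by simp [hq, hq'], by simp [div_mul_div_comm]⟩
  add_mem' := by
    rintro _ _ ⟨p, q, hq, rfl⟩ ⟨p', q', hq', rfl⟩
    refine ⟨p * q' + q * p', q * q', by simp [hq, hq'], ?_⟩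
    have h0 : q ≠ 0 := by rintro rfl; simp at hq
    have h0' : q' ≠ 0 := by rintro rfl; simp at hq'
    rw [div_add_div _ _ (by simpa using h0) (by simpa using h0')]
    simp
  algebraMap_mem' c := ⟨Polynomial.C c, 1, by simp, by simp [RatFunc.algebraMap_eq_C]⟩

/-- The local ring `𝒪_∞ ⊆ ℂ(t)` of `ℙ¹` at `∞`. -/
def localRingInfty : Subalgebra ℂ (RatFunc ℂ) where
  carrier := {f | ∃ p q : ℂ[X], q ≠ 0 ∧ p.natDegree ≤ q.natDegree ∧
    f = algebraMap ℂ[X] (RatFunc ℂ) p / algebraMap ℂ[X] (RatFunc ℂ) q}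
  mul_mem' := by
    rintro _ _ ⟨p, q, hq, hd, rfl⟩ ⟨p', q', hq', hd', rfl⟩
    refine ⟨p * p', q * q', mul_ne_zero hq hq', ?_, by simp [div_mul_div_comm]⟩
    rw [Polynomial.natDegree_mul hq hq']
    exact Polynomial.natDegree_mul_le.trans (add_le_add hd hd')
  add_mem' := by
    rintro _ _ ⟨p, q, hq, hd, rfl⟩ ⟨p', q', hq', hd', rfl⟩
    refine ⟨p * q' + q * p', q * q', mul_ne_zero hq hq', ?_, ?_⟩
    · rw [Polynomial.natDegree_mul hq hq']
      refine (Polynomial.natDegree_add_le _ _).trans (max_le ?_ ?_)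
      · exact Polynomial.natDegree_mul_le.trans (by omega)
      · exact Polynomial.natDegree_mul_le.trans (by omega)
    · rw [div_add_div _ _ (by simpa using hq) (by simpa using hq')]
      simp
  algebraMap_mem' c := ⟨Polynomial.C c, 1, one_ne_zero, by simp,
    by simp [RatFunc.algebraMap_eq_C]⟩

/-- The local ring of `ℙ¹` at a closed point. -/
def localRing (x : OnePoint ℂ) : Subalgebra ℂ (RatFunc ℂ) :=
  x.elim localRingInfty localRingFinite

/-- The ring `𝒪(U)` of regular functions on `U`. -/
def regular (U : ZOpen) : Subalgebra ℂ (RatFunc ℂ) where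
  carrier := {f | ∀ x, x ∈ U → f ∈ localRing x}
  mul_mem' hf hg x hx := mul_mem (hf x hx) (hg x hx)
  add_mem' hf hg x hx := add_mem (hf x hx) (hg x hx)
  algebraMap_mem' c x _ := (localRing x).algebraMap_mem c

theorem mem_regular {U : ZOpen} {f : RatFunc ℂ} :
    f ∈ regular U ↔ ∀ x, x ∈ U → f ∈ localRing x := Iff.rfl

theorem regular_mono {U V : ZOpen} (h : U ≤ V) : regular V ≤ regular U := fun _ hf =>
  mem_regular.2 fun x hx => mem_regular.1 hf x (h x hx)

/-! ### Points of the affine group scheme `G = Spec A` -/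

variable (A : Type u) [CommRing A] [HopfAlgebra ℂ A]

/-- The group `G(R) = Hom(A, R)` of `R`-points of `G = Spec A` (with the convolution product). -/
abbrev Pts (R : Type*) [CommRing R] [Algebra ℂ R] : Type _ := WithConv (A →ₐ[ℂ] R)

/-- The inverse of a point is its composition with the antipode. -/
instance instGroupPts (R : Type*) [CommRing R] [Algebra ℂ R] : Group (Pts A R) where
  inv g := toConv (g.ofConv.comp (HopfAlgebra.antipodeAlgHom ℂ A))
  inv_mul_cancel g := by
    have h1 : toConv ((toConv (g.ofConv.comp (HopfAlgebra.antipodeAlgHom ℂ A)) * g :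
        Pts A R).ofConv.toLinearMap) = 1 := by
      have h2 := LinearMap.algHom_comp_convMul_distrib g.ofConv
        (toConv (HopfAlgebra.antipode ℂ (A := A))) (toConv LinearMap.id)
      rw [LinearMap.antipode_mul_id] at h2
      rw [AlgHom.toLinearMap_convMul]
      refine (congrArg toConv h2).symm.trans ?_
      ext a
      simp
    exact ofConv_injective (AlgHom.toLinearMap_injective (toConv_injective h1))

variable {A} in
/-- The map `G(R) → G(S)` induced by `R → S`. -/
def Pts.map {R S : Type*} [CommRing R] [Algebra ℂ R] [CommRing S] [Algebra ℂ S]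
    (φ : R →ₐ[ℂ] S) (g : Pts A R) : Pts A S := toConv (φ.comp g.ofConv)

theorem lift_mem (S : Subalgebra ℂ (RatFunc ℂ)) {f g : A →ₐ[ℂ] RatFunc ℂ}
    (hf : ∀ a, f a ∈ S) (hg : ∀ a, g a ∈ S) (w : A ⊗[ℂ] A) :
    Algebra.TensorProduct.lift f g (fun _ _ => .all ..) w ∈ S := by
  induction w using TensorProduct.induction_on with
  | zero => simp
  | tmul a b => simpa using S.mul_mem (hf a) (hg b)
  | add x y hx hy => rw [map_add]; exact S.add_mem hx hy

/-- `G(S)` for a subring `S` of `ℂ(t)`, as a subgroup of `G(ℂ(t))`. -/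
def subPts (S : Subalgebra ℂ (RatFunc ℂ)) : Subgroup (Pts A (RatFunc ℂ)) where
  carrier := {g | ∀ a, g a ∈ S}
  mul_mem' := by
    intro f g hf hg a
    rw [AlgHom.convMul_apply]
    exact lift_mem A S hf hg _
  one_mem' := by
    intro a
    rw [AlgHom.convOne_apply]
    exact S.algebraMap_mem _
  inv_mem' := by
    intro g hg a
    exact hg _

/-- The group `G(U) = G(𝒪(U))` of regular maps `U → G`. -/
def points (U : ZOpen) : Subgroup (Pts A (RatFunc ℂ)) := subPts A (regular U)

variable {A} in
theorem mem_points {U : ZOpen} {g : Pts A (RatFunc ℂ)} :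
    g ∈ points A U ↔ ∀ x, x ∈ U → g ∈ subPts A (localRing x) :=
  ⟨fun h x hx a => mem_regular.1 (h a) x hx, fun h a => mem_regular.2 fun x hx => h x hx a⟩

variable {A} in
theorem points_mono {U V : ZOpen} (h : U ≤ V) : points A V ≤ points A U :=
  fun _ hg a => regular_mono h (hg a)

variable {A} in
/-- Restriction `G(V) → G(U)` for `U ⊆ V`. -/
def restr {U V : ZOpen} (h : U ≤ V) (g : points A V) : points A U := ⟨g.1, points_mono h g.2⟩

variable {A} in
theorem coe_restr {U V : ZOpen} (h : U ≤ V) (g : points A V) :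
    (restr h g : Pts A (RatFunc ℂ)) = g := Subtype.coe_mk _ _

/-! ### `G`-bundles -/

/-- A (Zariski locally trivial) `G`-bundle on `ℙ¹`, given by its sheaf of sections: a sheaf of
sets on `ℙ¹` with a simply transitive right action of the sheaf of groups `U ↦ G(U)` that has a
section near every point. Only nonempty open sets occur (over the empty set there is one section);
any two of them meet, since `ℙ¹` is irreducible. -/
structure GBundle where
  /-- sections over `U` -/
  sec : ZOpen → Type u
  /-- restriction of sections -/
  res : ∀ {U V : ZOpen}, U ≤ V → sec V → sec U
  res_refl : ∀ {U : ZOpen} (s : sec U), res (ZOpen.le_refl U) s = s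
  res_res : ∀ {U V W : ZOpen} (h : U ≤ V) (h' : V ≤ W) (s : sec W),
    res h (res h' s) = res (ZOpen.le_trans h h') s
  /-- the right action of `G(U)` on sections over `U` -/
  act : ∀ {U : ZOpen}, sec U → points A U → sec U
  act_one : ∀ {U : ZOpen} (s : sec U), act s 1 = s
  act_mul : ∀ {U : ZOpen} (s : sec U) (g h : points A U), act s (g * h) = act (act s g) h
  res_act : ∀ {U V : ZOpen} (h : U ≤ V) (s : sec V) (g : points A V),
    res h (act s g) = act (res h s) (restr h g)
  existsUnique_act : ∀ {U : ZOpen} (s t : sec U), ∃! g : points A U, act s g = t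
  existsUnique_glue : ∀ {ι : Type} (U : ι → ZOpen) (W : ZOpen) (hU : ∀ i, U i ≤ W)
    (_ : ∀ x, x ∈ W → ∃ i, x ∈ U i) (s : ∀ i, sec (U i))
    (_ : ∀ i j, res (ZOpen.inter_le_left (U i) (U j)) (s i) =
      res (ZOpen.inter_le_right (U i) (U j)) (s j)),
    ∃! t : sec W, ∀ i, res (hU i) t = s i
  exists_section : ∀ x : OnePoint ℂ, ∃ U : ZOpen, x ∈ U ∧ Nonempty (sec U)

variable {A}

namespace GBundle

/-- An isomorphism of `G`-bundles. -/
structure Iso (P Q : GBundle A) where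
  equiv : ∀ U : ZOpen, P.sec U ≃ Q.sec U
  equiv_res : ∀ {U V : ZOpen} (h : U ≤ V) (s : P.sec V),
    equiv U (P.res h s) = Q.res h (equiv V s)
  equiv_act : ∀ {U : ZOpen} (s : P.sec U) (g : points A U),
    equiv U (P.act s g) = Q.act (equiv U s) g

/-- Sections over `U` of the bundle glued from trivial bundles over `V` and `W` along `g`: pairs
of a section `left ∈ G(U ∩ V)` and a section `right ∈ G(U ∩ W)` with `left = g · right`. -/
structure GlueSec (V W : ZOpen) (g : points A (V.inter W)) (U : ZOpen) : Type u where
  left : Pts A (RatFunc ℂ)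
  right : Pts A (RatFunc ℂ)
  left_mem : left ∈ points A (U.inter V)
  right_mem : right ∈ points A (U.inter W)
  eq : left = g * right

namespace GlueSec

variable {V W : ZOpen} {g : points A (V.inter W)} {U U' : ZOpen}

theorem ext' {s t : GlueSec V W g U} (h : s.right = t.right) : s = t := by
  cases s with
  | mk l r hl hr e =>
    cases t with
    | mk l' r' hl' hr' e' =>
      have hrr : r = r' := h
      subst hrr
      have hll : l = l' := e.trans e'.symm
      subst hll
      rfl

/-- Restriction of sections. -/
def res (h : U ≤ U') (s : GlueSec V W g U') : GlueSec V W g U where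
  left := s.left
  right := s.right
  left_mem := points_mono (ZOpen.inter_mono h (ZOpen.le_refl V)) s.left_mem
  right_mem := points_mono (ZOpen.inter_mono h (ZOpen.le_refl W)) s.right_mem
  eq := s.eq

/-- The right action of `G(U)`. -/
def act (s : GlueSec V W g U) (c : points A U) : GlueSec V W g U where
  left := s.left * c
  right := s.right * c
  left_mem := mul_mem s.left_mem (points_mono (ZOpen.inter_le_left _ _) c.2)
  right_mem := mul_mem s.right_mem (points_mono (ZOpen.inter_le_left _ _) c.2)
  eq := by rw [s.eq, mul_assoc]

theorem res_right (h : U ≤ U') (s : GlueSec V W g U') : (res h s).right = s.right := rfl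

theorem act_right (s : GlueSec V W g U) (c : points A U) : (act s c).right = s.right * c := rfl

theorem existsUnique_act (hVW : ∀ x, x ∈ V ∨ x ∈ W) (s t : GlueSec V W g U) :
    ∃! c : points A U, act s c = t := by
  have key : s.left⁻¹ * t.left = s.right⁻¹ * t.right := by
    rw [s.eq, t.eq]; group
  have hmem : s.right⁻¹ * t.right ∈ points A U := by
    refine mem_points.2 fun x hx => ?_
    rcases hVW x with h | h
    · rw [← key]
      exact mem_points.1 (mul_mem (inv_mem s.left_mem) t.left_mem) x ⟨hx, h⟩
    · exact mem_points.1 (mul_mem (inv_mem s.right_mem) t.right_mem) x ⟨hx, h⟩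
  refine ⟨⟨_, hmem⟩, ?_, ?_⟩
  · apply ext'
    rw [act_right]
    exact mul_inv_cancel_left _ _
  · intro c hc
    apply Subtype.ext
    have h := act_right s c
    rw [hc] at h
    exact (eq_inv_mul_of_mul_eq h.symm)

theorem existsUnique_glue {ι : Type} (U : ι → ZOpen) (X : ZOpen) (hU : ∀ i, U i ≤ X)
    (hcov : ∀ x, x ∈ X → ∃ i, x ∈ U i) (s : ∀ i, GlueSec V W g (U i))
    (hs : ∀ i j, res (ZOpen.inter_le_left (U i) (U j)) (s i) =
      res (ZOpen.inter_le_right (U i) (U j)) (s j)) :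
    ∃! t : GlueSec V W g X, ∀ i, res (hU i) t = s i := by
  obtain ⟨x₀, hx₀⟩ := X.nonempty
  obtain ⟨i₀, -⟩ := hcov x₀ hx₀
  have hr : ∀ i, (s i).right = (s i₀).right := fun i => by
    simpa only [res_right] using congrArg GlueSec.right (hs i i₀)
  have hl : ∀ i, (s i).left = (s i₀).left := fun i => by
    rw [(s i).eq, (s i₀).eq, hr i]
  refine ⟨⟨(s i₀).left, (s i₀).right, ?_, ?_, (s i₀).eq⟩, ?_, ?_⟩
  · refine mem_points.2 fun x hx => ?_
    obtain ⟨i, hi⟩ := hcov x hx.1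
    rw [← hl i]
    exact mem_points.1 (s i).left_mem x ⟨hi, hx.2⟩
  · refine mem_points.2 fun x hx => ?_
    obtain ⟨i, hi⟩ := hcov x hx.1
    rw [← hr i]
    exact mem_points.1 (s i).right_mem x ⟨hi, hx.2⟩
  · intro i
    exact ext' (hr i).symm
  · intro t ht
    apply ext'
    simpa only [res_right] using congrArg GlueSec.right (ht i₀)

/-- The section over `W` that is `1` in the trivialization over `W`. -/
def one (V W : ZOpen) (g : points A (V.inter W)) : GlueSec V W g W where
  left := g
  right := 1
  left_mem := points_mono (ZOpen.inter_comm_le V W) g.2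
  right_mem := one_mem _
  eq := (mul_one _).symm

/-- The section over `V` that is `1` in the trivialization over `V`. -/
def one' (V W : ZOpen) (g : points A (V.inter W)) : GlueSec V W g V where
  left := 1
  right := (g : Pts A (RatFunc ℂ))⁻¹
  left_mem := one_mem _
  right_mem := inv_mem g.2
  eq := (mul_inv_cancel _).symm

end GlueSec

/-- The `G`-bundle obtained by gluing the trivial `G`-bundles on `V` and on `W` (`V ∪ W = ℙ¹`)
along `V ∩ W` using `g ∈ G(V ∩ W)`: the point `(y, b)` of `W × G` is identified with the point
`(y, g(y) b)` of `V × G`. -/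
def glue (V W : ZOpen) (hVW : ∀ x, x ∈ V ∨ x ∈ W) (g : points A (V.inter W)) : GBundle A where
  sec U := GlueSec V W g U
  res h s := GlueSec.res h s
  res_refl s := GlueSec.ext' (GlueSec.res_right _ s)
  res_res h h' s := GlueSec.ext' (by simp only [GlueSec.res_right])
  act s c := GlueSec.act s c
  act_one s := GlueSec.ext' (by rw [GlueSec.act_right, Subgroup.coe_one, mul_one])
  act_mul s c d := GlueSec.ext' (by
    simp only [GlueSec.act_right, Subgroup.coe_mul, mul_assoc])
  res_act h s c := GlueSec.ext' (by
    simp only [GlueSec.act_right, GlueSec.res_right, coe_restr])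
  existsUnique_act := GlueSec.existsUnique_act hVW
  existsUnique_glue := GlueSec.existsUnique_glue
  exists_section x := (hVW x).elim (fun h => ⟨V, h, ⟨GlueSec.one' V W g⟩⟩)
    (fun h => ⟨W, h, ⟨GlueSec.one V W g⟩⟩)

/-- The canonical trivialization (the constant section `1`) over `W` of the glued bundle. -/
def glueSection (V W : ZOpen) (hVW : ∀ x, x ∈ V ∨ x ∈ W) (g : points A (V.inter W)) :
    (glue V W hVW g).sec W := GlueSec.one V W g

/-- `s` is a section of `P` over `U ∖ {z}` which, if `z ∈ U`, is regular at `z` with respect to the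
trivialization `γ · h`. -/
def IsModifiedSec (P : GBundle A) (z : OnePoint ℂ) {V : ZOpen} (γ : P.sec V)
    (h : points A (V.erase z)) (U : ZOpen) (s : P.sec (U.erase z)) : Prop :=
  z ∈ U → ∃ b : points A (U.inter V),
    P.res (ZOpen.erase_mono (ZOpen.inter_le_left U V) z) s =
      P.act (P.res (ZOpen.le_trans (ZOpen.erase_le _ z) (ZOpen.inter_le_right U V)) γ)
        (restr (ZOpen.erase_mono (ZOpen.inter_le_right U V) z) h *
          restr (ZOpen.erase_le _ z) b)

section

variable {P : GBundle A} {z : OnePoint ℂ} {V : ZOpen} {γ : P.sec V} {h : points A (V.erase z)}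

theorem coe_eq_of_act_eq {U : ZOpen} {s : P.sec U} {c d : points A U}
    (e : P.act s c = P.act s d) : c = d :=
  (P.existsUnique_act s (P.act s d)).unique e rfl

theorem IsModifiedSec.res {U U' : ZOpen} {s : P.sec (U'.erase z)} (hs : P.IsModifiedSec z γ h U' s)
    (hU : U ≤ U') : P.IsModifiedSec z γ h U (P.res (ZOpen.erase_mono hU z) s) := by
  intro hz
  obtain ⟨b, hb⟩ := hs (hU z hz)
  refine ⟨restr (ZOpen.inter_mono hU (ZOpen.le_refl V)) b, ?_⟩
  have := congrArg (P.res (ZOpen.erase_mono (ZOpen.inter_mono hU (ZOpen.le_refl V)) z)) hb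
  rw [P.res_act, P.res_res, P.res_res] at this
  rw [P.res_res]
  exact this

theorem IsModifiedSec.act {U : ZOpen} {s : P.sec (U.erase z)} (hs : P.IsModifiedSec z γ h U s)
    (c : points A U) : P.IsModifiedSec z γ h U (P.act s (restr (ZOpen.erase_le U z) c)) := by
  intro hz
  obtain ⟨b, hb⟩ := hs hz
  refine ⟨b * restr (ZOpen.inter_le_left U V) c, ?_⟩
  rw [P.res_act, hb, ← P.act_mul]
  congr 1
  apply Subtype.ext
  simp only [Subgroup.coe_mul, coe_restr, mul_assoc]

theorem IsModifiedSec.mem_points {U : ZOpen} {s : P.sec (U.erase z)} {c : points A (U.erase z)}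
    (hzV : z ∈ V) (hs : P.IsModifiedSec z γ h U s) (hc : P.IsModifiedSec z γ h U (P.act s c)) :
    (c : Pts A (RatFunc ℂ)) ∈ points A U := by
  refine HeckeP1.mem_points.2 fun x hx => ?_
  by_cases hxz : x = z
  · subst hxz
    obtain ⟨b, hb⟩ := hs hx
    obtain ⟨b', hb'⟩ := hc hx
    rw [P.res_act, hb, ← P.act_mul] at hb'
    have := congrArg Subtype.val (coe_eq_of_act_eq hb')
    simp only [Subgroup.coe_mul, coe_restr, mul_assoc] at this
    have h2 : (c : Pts A (RatFunc ℂ)) = ((b⁻¹ * b' : points A (U.inter V)) : Pts A (RatFunc ℂ)) := by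
      rw [Subgroup.coe_mul, Subgroup.coe_inv]
      exact eq_inv_mul_of_mul_eq (mul_left_cancel this)
    rw [h2]
    exact HeckeP1.mem_points.1 (b⁻¹ * b').2 x ⟨hx, hzV⟩
  · exact HeckeP1.mem_points.1 c.2 x ⟨hx, hxz⟩

theorem heckeExistsUnique_act (hzV : z ∈ V) {U : ZOpen}
    (s t : {s : P.sec (U.erase z) // P.IsModifiedSec z γ h U s}) :
    ∃! c : points A U, (⟨P.act s.1 (restr (ZOpen.erase_le U z) c), s.2.act c⟩ :
      {s : P.sec (U.erase z) // P.IsModifiedSec z γ h U s}) = t := by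
  obtain ⟨c, hc, hc'⟩ := P.existsUnique_act s.1 t.1
  have hc : P.act s.1 c = t.1 := hc
  have hm : (c : Pts A (RatFunc ℂ)) ∈ points A U :=
    IsModifiedSec.mem_points hzV s.2 (hc.symm ▸ t.2)
  refine ⟨⟨c, hm⟩, Subtype.ext hc, ?_⟩
  intro d hd
  have := hc' _ (congrArg Subtype.val hd)
  apply Subtype.ext
  have h2 := congrArg Subtype.val this
  simpa only [coe_restr] using h2

theorem heckeExistsUnique_glue (hzV : z ∈ V) {ι : Type} (U : ι → ZOpen) (W : ZOpen)
    (hU : ∀ i, U i ≤ W) (hcov : ∀ x, x ∈ W → ∃ i, x ∈ U i)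
    (s : ∀ i, {s : P.sec ((U i).erase z) // P.IsModifiedSec z γ h (U i) s})
    (hs : ∀ i j, P.res (ZOpen.erase_mono (ZOpen.inter_le_left (U i) (U j)) z) (s i).1 =
      P.res (ZOpen.erase_mono (ZOpen.inter_le_right (U i) (U j)) z) (s j).1) :
    ∃! t : {s : P.sec (W.erase z) // P.IsModifiedSec z γ h W s},
      ∀ i, P.res (ZOpen.erase_mono (hU i) z) t.1 = (s i).1 := by
  obtain ⟨t, ht, ht'⟩ := P.existsUnique_glue (fun i => (U i).erase z) (W.erase z)
    (fun i => ZOpen.erase_mono (hU i) z)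
    (fun x hx => (hcov x hx.1).imp fun i hi => ⟨hi, hx.2⟩) (fun i => (s i).1) (by
      intro i j
      have hle : ((U i).erase z).inter ((U j).erase z) ≤ ((U i).inter (U j)).erase z :=
        fun x hx => ⟨⟨hx.1.1, hx.2.1⟩, hx.1.2⟩
      have := congrArg (P.res hle) (hs i j)
      rw [P.res_res, P.res_res] at this
      exact this)
  have hmod : P.IsModifiedSec z γ h W t := by
    intro hzW
    obtain ⟨i, hi⟩ := hcov z hzW
    obtain ⟨b, hb⟩ := (s i).2 hi
    rw [← ht i, P.res_res] at hb
    obtain ⟨k, hk, -⟩ := P.existsUnique_act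
      (P.act (P.res (ZOpen.le_trans (ZOpen.erase_le _ z) (ZOpen.inter_le_right W V)) γ)
        (restr (ZOpen.erase_mono (ZOpen.inter_le_right W V) z) h))
      (P.res (ZOpen.erase_mono (ZOpen.inter_le_left W V) z) t)
    have hk : P.act _ k = _ := hk
    have hkm : (k : Pts A (RatFunc ℂ)) ∈ points A (W.inter V) := by
      have h1 := congrArg
        (P.res (ZOpen.erase_mono (ZOpen.inter_mono (hU i) (ZOpen.le_refl V)) z)) hk
      rw [P.res_act, P.res_act, P.res_res, P.res_res, hb, ← P.act_mul] at h1
      have h2 := congrArg Subtype.val (coe_eq_of_act_eq h1)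
      simp only [Subgroup.coe_mul, coe_restr] at h2
      refine HeckeP1.mem_points.2 fun x hx => ?_
      by_cases hxz : x = z
      · rw [mul_left_cancel h2, hxz]
        exact HeckeP1.mem_points.1 b.2 z ⟨hi, hzV⟩
      · exact HeckeP1.mem_points.1 k.2 x ⟨hx, hxz⟩
    refine ⟨⟨k, hkm⟩, ?_⟩
    rw [← hk, ← P.act_mul]
    congr 1
  refine ⟨⟨t, hmod⟩, ht, ?_⟩
  intro t₂ ht₂
  exact Subtype.ext (ht' t₂.1 ht₂)

theorem heckeExists_section (hzV : z ∈ V) (x : OnePoint ℂ) : ∃ U : ZOpen, x ∈ U ∧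
    Nonempty {s : P.sec (U.erase z) // P.IsModifiedSec z γ h U s} := by
  by_cases hxz : x = z
  · refine ⟨V, hxz ▸ hzV, ⟨⟨P.act (P.res (ZOpen.erase_le V z) γ) h, ?_⟩⟩⟩
    intro _
    refine ⟨1, ?_⟩
    rw [P.res_act, P.res_res]
    congr 1
    apply Subtype.ext
    simp only [Subgroup.coe_mul, coe_restr, Subgroup.coe_one, mul_one]
  · obtain ⟨U, hU, ⟨s⟩⟩ := P.exists_section x
    exact ⟨U.erase z, ⟨hU, hxz⟩, ⟨⟨P.res (ZOpen.le_trans (ZOpen.erase_le _ z) (ZOpen.erase_le U z)) s,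
      fun hz => absurd rfl hz.2⟩⟩⟩

end

/-- The Hecke modification of `P` at `z` with respect to a trivialization `γ` of `P` on an open
neighbourhood `V` of `z` and `h ∈ G(V ∖ {z})`: the bundle that agrees with `P` outside `z` and for
which `γ' = γ · h` is a trivialization near `z`. It is glued from `P|_{ℙ¹ ∖ {z}}` and the
trivial bundle on `V`. -/
def hecke (P : GBundle A) (z : OnePoint ℂ) {V : ZOpen} (hz : z ∈ V) (γ : P.sec V)
    (h : points A (V.erase z)) : GBundle A where
  sec U := {s : P.sec (U.erase z) // P.IsModifiedSec z γ h U s}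
  res hU s := ⟨P.res (ZOpen.erase_mono hU z) s.1, s.2.res hU⟩
  res_refl s := Subtype.ext (P.res_refl s.1)
  res_res hU hU' s := Subtype.ext (P.res_res _ _ s.1)
  act s c := ⟨P.act s.1 (restr (ZOpen.erase_le _ z) c), s.2.act c⟩
  act_one s := Subtype.ext (P.act_one s.1)
  act_mul s c d := Subtype.ext (P.act_mul s.1 (restr (ZOpen.erase_le _ z) c)
    (restr (ZOpen.erase_le _ z) d))
  res_act hU s c := Subtype.ext (P.res_act _ s.1 _)
  existsUnique_act := heckeExistsUnique_act hz
  existsUnique_glue U W hU hcov s hs := by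
    have := heckeExistsUnique_glue hz U W hU hcov s
      (fun i j => congrArg Subtype.val (hs i j))
    simpa only [Subtype.ext_iff] using this
  exists_section := heckeExists_section hz

end GBundle

/-! ### The Lie algebra of `G` -/

variable (A) in
/-- The Lie algebra `𝔤` of `G = Spec A`: the left invariant derivations of the ring `A` of regular
functions on `G`. -/
def LieAlg : LieSubalgebra ℂ (Derivation ℂ A A) where
  carrier := {D | ∀ a, comul (R := ℂ) (D a) = (D : A →ₗ[ℂ] A).lTensor A (comul a)}
  add_mem' := by
    intro D E hD hE a
    simp only [Set.mem_ofPred_eq] at hD hE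
    rw [Derivation.add_apply, map_add, hD, hE, Derivation.coe_add_linearMap, LinearMap.lTensor_add,
      LinearMap.add_apply]
  zero_mem' := by intro a; simp
  smul_mem' := by
    intro c D hD a
    simp only [Set.mem_ofPred_eq] at hD
    rw [Derivation.smul_apply, map_smul, hD, Derivation.coe_smul_linearMap, LinearMap.lTensor_smul,
      LinearMap.smul_apply]
  lie_mem' := by
    intro D E hD hE a
    simp only [Set.mem_ofPred_eq] at hD hE
    have key : ∀ (F F' : Derivation ℂ A A),
        (∀ a, comul (R := ℂ) (F a) = (F : A →ₗ[ℂ] A).lTensor A (comul a)) →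
        (∀ a, comul (R := ℂ) (F' a) = (F' : A →ₗ[ℂ] A).lTensor A (comul a)) →
        comul (R := ℂ) (F (F' a)) = ((F : A →ₗ[ℂ] A) ∘ₗ (F' : A →ₗ[ℂ] A)).lTensor A (comul a) := by
      intro F F' hF hF'
      rw [hF, hF', ← LinearMap.comp_apply, ← LinearMap.lTensor_comp]
    have hl : ((⁅D, E⁆ : Derivation ℂ A A) : A →ₗ[ℂ] A) =
        (D : A →ₗ[ℂ] A) ∘ₗ (E : A →ₗ[ℂ] A) - (E : A →ₗ[ℂ] A) ∘ₗ (D : A →ₗ[ℂ] A) := by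
      ext b; exact Derivation.commutator_apply (D1 := D) (D2 := E) (a := b)
    rw [hl, LinearMap.lTensor_sub, LinearMap.sub_apply, ← key D E hD hE, ← key E D hE hD,
      Derivation.commutator_apply, map_sub]

/-- A left invariant derivation is determined by its value at the identity. -/
theorem LieAlg.apply_eq (D : LieAlg A) (a : A) :
    D.1 a = TensorProduct.rid ℂ A
      (((counit (R := ℂ) (A := A)) ∘ₗ (D.1 : A →ₗ[ℂ] A)).lTensor A (comul a)) := by
  have h := congrArg (fun w => TensorProduct.rid ℂ A ((counit (R := ℂ) (A := A)).lTensor A w)) (D.2 a)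
  simp only [Coalgebra.lTensor_counit_comul] at h
  rw [LinearMap.lTensor_comp, LinearMap.comp_apply, ← h]
  simp

instance instFiniteLieAlg [Algebra.FiniteType ℂ A] : FiniteDimensional ℂ (LieAlg A) := by
  obtain ⟨s, hs⟩ := (Algebra.FiniteType.out : (⊤ : Subalgebra ℂ A).FG)
  let φ : LieAlg A →ₗ[ℂ] (s → ℂ) :=
    { toFun := fun D a => counit (R := ℂ) (D.1 a.1)
      map_add' := fun D E => by ext a; simp
      map_smul' := fun c D => by ext a; simp }
  refine Module.Finite.of_injective φ ?_
  rw [← LinearMap.ker_eq_bot, LinearMap.ker_eq_bot']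
  intro D hD
  have h0 : ∀ a : A, counit (R := ℂ) (D.1 a) = 0 := by
    intro a
    have ha : a ∈ Algebra.adjoin ℂ (s : Set A) := hs ▸ Algebra.mem_top
    induction ha using Algebra.adjoin_induction with
    | mem x hx => exact congrFun hD ⟨x, hx⟩
    | algebraMap r => simp
    | add x y _ _ hx hy => simp [hx, hy]
    | mul x y _ _ hx hy => simp [hx, hy]
  have h1 : (counit (R := ℂ) (A := A)) ∘ₗ (D.1 : A →ₗ[ℂ] A) = 0 := by
    ext a; exact h0 a
  apply Subtype.ext
  ext a
  rw [LieAlg.apply_eq, h1]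
  simp

/-! ### Exponentials of locally nilpotent elements -/

/-- `x` acts locally nilpotently on the ring `A` of regular functions on `G`. -/
def LocNilp (x : LieAlg A) : Prop := ∀ a : A, ∃ n : ℕ, (x.1 : A →ₗ[ℂ] A)^[n] a = 0

theorem isNilpotent_of_commutator {R : Type*} [Ring R] [Algebra ℂ R] [FiniteDimensional ℂ R]
    {e d : R} {c : ℂ} (hc : c ≠ 0) (h : e * d - d * e = c • d) : IsNilpotent d := by
  by_contra hd
  have hk : ∀ k : ℕ, e * d ^ k - d ^ k * e = ((k : ℂ) * c) • d ^ k := by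
    intro k
    induction k with
    | zero => simp
    | succ k ih =>
      have : e * d ^ (k + 1) - d ^ (k + 1) * e =
          (e * d ^ k - d ^ k * e) * d + d ^ k * (e * d - d * e) := by
        rw [pow_succ]; noncomm_ring
      rw [this, ih, h, smul_mul_assoc, mul_smul_comm, ← pow_succ, ← add_smul]
      push_cast; ring_nf
  let φ : Module.End ℂ R := LinearMap.mulLeft ℂ e - LinearMap.mulRight ℂ e
  have hev : ∀ k : ℕ, φ.HasEigenvalue ((k : ℂ) * c) := fun k =>
    Module.End.hasEigenvalue_of_hasEigenvector (x := d ^ k)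
      ⟨Module.End.mem_eigenspace_iff.2 (hk k), fun h0 => hd ⟨k, h0⟩⟩
  have hinf : (Set.range fun k : ℕ => (k : ℂ) * c).Infinite :=
    Set.infinite_range_of_injective fun k l hkl => by
      simpa [hc] using hkl
  exact hinf (φ.finite_hasEigenvalue.subset (by rintro _ ⟨k, rfl⟩; exact hev k))

variable (A) in
/-- The left invariant linear endomorphisms of `A`. -/
def leftInvariantEnd : Submodule ℂ (A →ₗ[ℂ] A) where
  carrier := {w | ∀ a, comul (R := ℂ) (w a) = w.lTensor A (comul a)}
  add_mem' := by
    intro v w hv hw a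
    simp only [Set.mem_ofPred_eq] at hv hw
    rw [LinearMap.add_apply, map_add, hv, hw, LinearMap.lTensor_add, LinearMap.add_apply]
  zero_mem' := by intro a; simp
  smul_mem' := by
    intro c w hw a
    simp only [Set.mem_ofPred_eq] at hw
    rw [LinearMap.smul_apply, map_smul, hw, LinearMap.lTensor_smul, LinearMap.smul_apply]

/-- The span of all left invariant translates of `a`. -/
def translates (a : A) : Submodule ℂ A := (leftInvariantEnd A).map (LinearMap.applyₗ a)

theorem self_mem_translates (a : A) : a ∈ translates a :=
  ⟨LinearMap.id, fun b => by simp, rfl⟩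

theorem LieAlg.apply_mem_translates (x : LieAlg A) {a b : A} (hb : b ∈ translates a) :
    (x.1 : A →ₗ[ℂ] A) b ∈ translates a := by
  obtain ⟨w, hw, rfl⟩ := hb
  refine ⟨(x.1 : A →ₗ[ℂ] A) ∘ₗ w, fun b => ?_, rfl⟩
  rw [LinearMap.comp_apply, LinearMap.lTensor_comp, LinearMap.comp_apply, ← hw b]
  exact x.2 (w b)

instance instFiniteTranslates (a : A) : FiniteDimensional ℂ (translates a) := by
  let ψ : Module.Dual ℂ A →ₗ[ℂ] A :=
    { toFun := fun f => TensorProduct.rid ℂ A (f.lTensor A (comul a))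
      map_add' := fun f g => by rw [LinearMap.lTensor_add, LinearMap.add_apply, map_add]
      map_smul' := fun c f => by
        rw [LinearMap.lTensor_smul, LinearMap.smul_apply, map_smul, RingHom.id_apply] }
  classical
  obtain ⟨s, hs⟩ : ∃ s : Finset (A × A), comul (R := ℂ) a = ∑ i ∈ s, i.1 ⊗ₜ i.2 :=
    TensorProduct.exists_finset _
  have hfin : FiniteDimensional ℂ (Submodule.span ℂ ((s.image Prod.fst : Finset A) : Set A)) :=
    FiniteDimensional.span_finset ℂ _
  refine Submodule.finiteDimensional_of_le
    (S₂ := Submodule.span ℂ ((s.image Prod.fst : Finset A) : Set A)) ?_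
  rintro _ ⟨w, hw, rfl⟩
  have h1 : w a = ψ (counit (R := ℂ) (A := A) ∘ₗ w) := by
    have h := congrArg (fun v => TensorProduct.rid ℂ A ((counit (R := ℂ) (A := A)).lTensor A v))
      (hw a)
    simp only [Coalgebra.lTensor_counit_comul] at h
    show w a = TensorProduct.rid ℂ A ((counit (R := ℂ) (A := A) ∘ₗ w).lTensor A (comul a))
    rw [LinearMap.lTensor_comp, LinearMap.comp_apply, ← h]
    simp
  show w a ∈ _
  rw [h1]
  show TensorProduct.rid ℂ A ((counit (R := ℂ) (A := A) ∘ₗ w).lTensor A (comul a)) ∈ _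
  rw [hs, map_sum, map_sum]
  refine Submodule.sum_mem _ fun i hi => ?_
  rw [LinearMap.lTensor_tmul, TensorProduct.rid_tmul]
  exact Submodule.smul_mem _ _ (Submodule.subset_span (by
    simpa using ⟨i.2, hi⟩))

theorem locNilp_of_lie_eq_smul {x y : LieAlg A} {c : ℂ} (hc : c ≠ 0) (h : ⁅y, x⁆ = c • x) :
    LocNilp x := by
  intro a
  let d : Module.End ℂ (translates a) :=
    (x.1 : A →ₗ[ℂ] A).restrict fun _ hb => LieAlg.apply_mem_translates x hb
  let e : Module.End ℂ (translates a) :=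
    (y.1 : A →ₗ[ℂ] A).restrict fun _ hb => LieAlg.apply_mem_translates y hb
  have hde : e * d - d * e = c • d := by
    ext b
    have := congrArg (fun D : LieAlg A => D.1 b.1) h
    simp only [LieSubalgebra.coe_bracket, Derivation.commutator_apply] at this
    exact this
  obtain ⟨n, hn⟩ := isNilpotent_of_commutator (R := Module.End ℂ (translates a)) hc hde
  have hpow : ∀ (k : ℕ) (b : translates a),
      (((d ^ k) b : translates a) : A) = (x.1 : A →ₗ[ℂ] A)^[k] b := by
    intro k
    induction k with
    | zero => intro b; rfl
    | succ k ih =>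
      intro b
      rw [pow_succ, Module.End.mul_apply, ih, Function.iterate_succ_apply]
      rfl
  refine ⟨n, ?_⟩
  rw [← hpow n ⟨a, self_mem_translates a⟩, hn]
  rfl

/-- Root vectors act locally nilpotently. -/
theorem locNilp_of_mem_rootSpace [Algebra.FiniteType ℂ A] [LieAlgebra.IsSimple ℂ (LieAlg A)]
    (H : LieSubalgebra ℂ (LieAlg A)) [H.IsCartanSubalgebra] (α : H.root) {x : LieAlg A}
    (hx : x ∈ LieAlgebra.rootSpace H α.1) : LocNilp x :=
  locNilp_of_lie_eq_smul (y := (LieAlgebra.IsKilling.coroot α.1 : H)) (c := 2) two_ne_zero (by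
    have hα : α.1.IsNonZero := (Finset.mem_filter.1 α.2).2
    have := LieAlgebra.IsKilling.lie_eq_smul_of_mem_rootSpace hx (LieAlgebra.IsKilling.coroot α.1)
    rwa [LieAlgebra.IsKilling.root_apply_coroot hα] at this)

/-- The function `s ↦ a(exp(s x))`: its `n`-th Taylor coefficient is `(xⁿ a)(e) / n!`. -/
def expFun (x : LieAlg A) (hx : LocNilp x) (a : A) : ℂ[X] :=
  ∑ n ∈ Finset.range (hx a).choose,
    Polynomial.monomial n ((n.factorial : ℂ)⁻¹ * counit (R := ℂ) ((x.1 : A →ₗ[ℂ] A)^[n] a))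

theorem coeff_expFun (x : LieAlg A) (hx : LocNilp x) (a : A) (n : ℕ) :
    (expFun x hx a).coeff n =
      (n.factorial : ℂ)⁻¹ * counit (R := ℂ) ((x.1 : A →ₗ[ℂ] A)^[n] a) := by
  rw [expFun, Polynomial.finsetSum_coeff]
  simp only [Polynomial.coeff_monomial]
  rw [Finset.sum_ite_eq' (Finset.range (hx a).choose) n]
  split_ifs with h
  · rfl
  · have hle : (hx a).choose ≤ n := by simpa using h
    obtain ⟨m, rfl⟩ := Nat.exists_eq_add_of_le' hle
    rw [Function.iterate_add_apply, (hx a).choose_spec, iterate_map_zero, map_zero, mul_zero]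

theorem counit_iterate_mul (D : Derivation ℂ A A) (n : ℕ) (a b : A) :
    (n.factorial : ℂ)⁻¹ * counit (R := ℂ) ((D : A →ₗ[ℂ] A)^[n] (a * b)) =
      ∑ p ∈ Finset.HasAntidiagonal.antidiagonal n,
        ((p.1.factorial : ℂ)⁻¹ * counit (R := ℂ) ((D : A →ₗ[ℂ] A)^[p.1] a)) *
        ((p.2.factorial : ℂ)⁻¹ * counit (R := ℂ) ((D : A →ₗ[ℂ] A)^[p.2] b)) := by
  have h : (D : A →ₗ[ℂ] A)^[n] (a * b) = ∑ p ∈ Finset.HasAntidiagonal.antidiagonal n,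
      n.choose p.1 • ((D : A →ₗ[ℂ] A)^[p.1] a * (D : A →ₗ[ℂ] A)^[p.2] b) := by
    induction n with
    | zero => simp
    | succ n ih =>
      rw [Finset.sum_antidiagonal_choose_succ_nsmul
        (M := A) (fun i j => (D : A →ₗ[ℂ] A)^[i] a * (D : A →ₗ[ℂ] A)^[j] b) n,
        Function.iterate_succ_apply', ih, map_sum, ← Finset.sum_add_distrib]
      refine Finset.sum_congr rfl fun p hp => ?_
      have hp' : p.1 + p.2 = n := by simpa using hp
      rw [map_nsmul, Function.iterate_succ_apply', Function.iterate_succ_apply',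
        ← Nat.choose_symm_of_eq_add hp'.symm, ← smul_add]
      congr 1
      simp only [Derivation.coeFn_coe, Derivation.leibniz, smul_eq_mul]
      ring
  rw [h, map_sum, Finset.mul_sum]
  refine Finset.sum_congr rfl fun p hp => ?_
  have hp' : p.1 + p.2 = n := by simpa using hp
  subst hp'
  rw [map_nsmul, Bialgebra.counit_mul, nsmul_eq_mul, Nat.choose_symm_add,
    Nat.add_choose, Nat.cast_div (Nat.factorial_mul_factorial_dvd_factorial_add _ _)
      (by exact_mod_cast (Nat.mul_pos (Nat.factorial_pos _) (Nat.factorial_pos _)).ne')]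
  have h1 : (p.1.factorial : ℂ) ≠ 0 := by exact_mod_cast p.1.factorial_ne_zero
  have h2 : (p.2.factorial : ℂ) ≠ 0 := by exact_mod_cast p.2.factorial_ne_zero
  have h3 : ((p.1 + p.2).factorial : ℂ) ≠ 0 := by exact_mod_cast (p.1 + p.2).factorial_ne_zero
  push_cast
  field_simp

/-- The element `s ↦ exp(s x)` of `G(ℂ[s])`. -/
def expCurve (x : LieAlg A) (hx : LocNilp x) : Pts A ℂ[X] := toConv
  { toFun := expFun x hx
    map_one' := by
      ext n
      rw [coeff_expFun, Polynomial.coeff_one]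
      cases n with
      | zero => simp
      | succ n => simp [Function.iterate_succ_apply]
    map_zero' := by ext n; rw [coeff_expFun, iterate_map_zero]; simp
    map_add' := fun a b => by
      ext n; rw [Polynomial.coeff_add, coeff_expFun, coeff_expFun, coeff_expFun, iterate_map_add,
        map_add, mul_add]
    map_mul' := fun a b => by
      ext n
      rw [Polynomial.coeff_mul, coeff_expFun]
      simp only [coeff_expFun]
      exact counit_iterate_mul x.1 n a b
    commutes' := fun c => by
      ext n
      rw [coeff_expFun, ← Polynomial.C_eq_algebraMap, Polynomial.coeff_C]
      cases n with
      | zero => simp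
      | succ n => simp [Function.iterate_succ_apply] }

/-- The element `exp(x t ^ j)` of `G(ℂ[t, t⁻¹])`. -/
def expT (x : LieAlg A) (hx : LocNilp x) (j : ℕ) : Pts A ℂ[T;T⁻¹] :=
  Pts.map (Polynomial.aeval (LaurentPolynomial.T (j : ℤ))) (expCurve x hx)

/-! ### Coweights -/

/-- The derivative at `T = 1` of a Laurent polynomial. -/
def derivOne (f : ℂ[T;T⁻¹]) : ℂ := Finsupp.sum f.coeff fun n c => (n : ℂ) * c

/-- A coweight of `G` with respect to the Cartan subalgebra `H`: a cocharacter `𝔾ₘ → G`, i.e. a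
morphism of bialgebras `A → ℂ[T, T⁻¹]`, whose derivative at the identity is an element `val` of
`H`; this derivative is the tangent vector `a ↦ d/dT (cochar a) |_{T = 1}`. -/
structure Coweight (H : LieSubalgebra ℂ (LieAlg A)) where
  cochar : A →ₐc[ℂ] ℂ[T;T⁻¹]
  val : H
  counit_val : ∀ a : A, counit (R := ℂ) (val.1.1 a) = derivOne (cochar a)

namespace Coweight

variable {H : LieSubalgebra ℂ (LieAlg A)}

/-- The element `t ^ μ` of `G(ℂ[t, t⁻¹])`. -/
def tPow (μ : Coweight H) : Pts A ℂ[T;T⁻¹] := toConv (μ.cochar : A →ₐ[ℂ] ℂ[T;T⁻¹])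

end Coweight

/-! ### Substituting `t - z` for `t` -/

/-- `t - z` as a unit of `ℂ(t)`. -/
def shiftUnit (z : ℂ) : (RatFunc ℂ)ˣ :=
  Units.mk0 (algebraMap ℂ[X] (RatFunc ℂ) (Polynomial.X - Polynomial.C z))
    (RatFunc.algebraMap_ne_zero (Polynomial.X_sub_C_ne_zero z))

/-- The substitution `ℂ[t, t⁻¹] → ℂ(t)`, `f(t) ↦ f(t - z)`. -/
def shift (z : ℂ) : ℂ[T;T⁻¹] →ₐ[ℂ] RatFunc ℂ :=
  AddMonoidAlgebra.lift ℂ (RatFunc ℂ) ℤ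
    ((Units.coeHom (RatFunc ℂ)).comp (zpowersHom (RatFunc ℂ)ˣ (shiftUnit z)))

theorem shift_single (z : ℂ) (n : ℤ) (c : ℂ) : shift z (AddMonoidAlgebra.single n c) =
    c • (algebraMap ℂ[X] (RatFunc ℂ) (Polynomial.X - Polynomial.C z)) ^ n := by
  rw [shift, AddMonoidAlgebra.lift_single]
  simp [shiftUnit]

theorem shift_mem_localRing (z w : ℂ) (hzw : w ≠ z) (f : ℂ[T;T⁻¹]) :
    shift z f ∈ localRingFinite w := by
  have hX : ∀ n : ℕ, (algebraMap ℂ[X] (RatFunc ℂ) (Polynomial.X - Polynomial.C z)) ^ n ∈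
      localRingFinite w := fun n =>
    ⟨(Polynomial.X - Polynomial.C z) ^ n, 1, by simp, by rw [map_pow, map_one, div_one]⟩
  have hX' : ∀ n : ℕ, ((algebraMap ℂ[X] (RatFunc ℂ) (Polynomial.X - Polynomial.C z)) ^ n)⁻¹ ∈
      localRingFinite w := fun n =>
    ⟨1, (Polynomial.X - Polynomial.C z) ^ n, by simp [sub_ne_zero.2 hzw],
      by rw [map_pow, map_one, one_div]⟩
  induction f using AddMonoidAlgebra.induction_linear with
  | zero => simp
  | add f g hf hg => rw [map_add]; exact add_mem hf hg
  | single n c =>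
    rw [shift_single]
    refine Subalgebra.smul_mem _ ?_ c
    cases n with
    | ofNat n => simpa using hX n
    | negSucc n => rw [zpow_negSucc]; exact hX' (n + 1)

/-- For `h ∈ G(ℂ[t, t⁻¹])`, the element `h(t - z)` is regular on `𝔸¹ ∖ {z}`. -/
theorem map_shift_mem (h : Pts A ℂ[T;T⁻¹]) (z : ℂ) {U : ZOpen}
    (hU : ∀ x, x ∈ U → x ≠ OnePoint.infty ∧ x ≠ (z : OnePoint ℂ)) :
    Pts.map (shift z) h ∈ points A U := by
  refine mem_points.2 fun x hx a => ?_
  obtain ⟨h1, h2⟩ := hU x hx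
  obtain ⟨w, rfl⟩ := OnePoint.ne_infty_iff_exists.1 h1
  exact shift_mem_localRing z w (fun e => h2 (by rw [e])) _

/-! ### Bundles of coweights and their Hecke modifications -/

/-- The `G`-bundle on `ℙ¹` defined by the coweight `μ`: the trivial `G`-bundles on `𝔸¹` and on
`𝔸¹_∞` are glued along `𝔸¹ ∖ {0}` using `t ^ μ`. -/
def bundle {H : LieSubalgebra ℂ (LieAlg A)} (μ : Coweight H) : GBundle A :=
  GBundle.glue ZOpen.affineInfty ZOpen.affine ZOpen.cover_affine
    ⟨Pts.map (shift 0) μ.tPow, map_shift_mem _ _ fun _ hx => ⟨hx.2.2, hx.1.2⟩⟩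

/-- The nonvanishing tangent vectors `(z, v)` of `𝔸¹`. -/
abbrev TangentPt := ℂ × ℂˣ

/-- The Hecke modification of the bundle of `μ` with respect to the Hecke parameter
`((z, v), h)`, where `h ∈ G(ℂ[t, t⁻¹])` represents a point of the affine Grassmannian: it is the
modification at `z` with respect to the given trivialization on `𝔸¹` and `h(t - z)`. -/
def heckeBundle {H : LieSubalgebra ℂ (LieAlg A)} (μ : Coweight H) (p : TangentPt)
    (h : Pts A ℂ[T;T⁻¹]) : GBundle A :=
  (bundle μ).hecke (p.1 : OnePoint ℂ) (ZOpen.coe_mem_affine p.1)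
    (GBundle.glueSection ZOpen.affineInfty ZOpen.affine ZOpen.cover_affine _)
    ⟨Pts.map (shift p.1) h, map_shift_mem _ _ fun _ hx => ⟨hx.1.2, hx.2⟩⟩

/-- `λ` is dominant with respect to the positive roots of the base `b`: `α(λ) ≥ 0` for all positive
roots `α`. -/
def Coweight.IsDominant [Algebra.FiniteType ℂ A] [LieAlgebra.IsSimple ℂ (LieAlg A)]
    {H : LieSubalgebra ℂ (LieAlg A)} [H.IsCartanSubalgebra]
    (b : (LieAlgebra.IsKilling.rootSystem H).Base) (lam : Coweight H) : Prop :=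
  ∀ α : H.root, b.IsPos α → 0 ≤ α.1 lam.val

end HeckeP1
end

noncomputable section

namespace HeckeP1

variable {A : Type u} [CommRing A] [HopfAlgebra ℂ A]
variable {R S : Type*} [CommRing R] [Algebra ℂ R] [CommRing S] [Algebra ℂ S]

/-! ### The convolution algebra of linear maps on the ring of functions of `G` -/

/-! Everything takes place in the convolution algebra `Fn A R` of linear maps `A → R`. It contains
`G(R)` as the algebra homomorphisms and, through functionals with constant values, the Lie algebra
as tangent vectors at the identity, with the commutator as bracket. Group identities can then be
proved by differentiation: `exp(s x)` solves `f' = x f`, a cocharacter with derivative `v` is the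
solution of `T df/dT = v f` with value `1` at `T = 1` (`IsCochar`), and solutions are unique in
characteristic zero.

Complete `x` to an `𝔰𝔩₂`-triple `(h, x, y)` with `h = α^∨`. The curve `exp(-T⁻¹ y) exp(T x) exp(-T⁻¹
y)` equals `w T^{-h}` with `w` constant (`theta_weylCurve`, `isCochar_corootCurve`), so that
`exp(T^n x) = exp(T^{-n} y) w T^{-nh} exp(T^{-n} y)` (`expAt_T_eq`). With `l = α(λ)`, `m = α(μ)` and
`n = j + m`, moving cocharacters past exponentials gives `t^μ exp(x t^j) t^λ = exp(t^n x) t^{μ+λ} =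
exp(t^{-n} y) w · t^ν · exp(t^{l-j} y)`. Since `m ≥ 0` and `j < l`, the factor before `t^ν` is
polynomial in `t⁻¹` and the one after it is polynomial in `t` (`exists_coweight_factorization`).

The first factor, with `t - z` for `t`, extends over `∞` and the last one over `z`, so both are
absorbed by changes of trivialization (`heckeIso`, `nonempty_iso_of_factorization`). Replacing `t`
by `t - z` in a cocharacter is harmless at `∞`, because `(t - z) / t` is a unit there. As `ν` does
not involve `(z, v)`, independence of the point follows. -/

variable (A R) in
/-- The linear maps `A → R` with the convolution product. -/
abbrev Fn := WithConv (A →ₗ[ℂ] R)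

namespace Fn

/-- Composition with a linear map of the values. -/
def comp (l : R →ₗ[ℂ] S) : Fn A R →ₗ[ℂ] Fn A S where
  toFun f := toConv (l ∘ₗ f.ofConv)
  map_add' f g := by ext a; simp
  map_smul' c f := by ext a; simp

@[simp] theorem comp_apply (l : R →ₗ[ℂ] S) (f : Fn A R) (a : A) : comp l f a = l (f a) := rfl

/-- Composition with a homomorphism of the values. -/
def map (φ : R →ₐ[ℂ] S) : Fn A R →ₐ[ℂ] Fn A S :=
  AlgHom.ofLinearMap (comp φ.toLinearMap) (by ext a; simp) (by
    intro f g
    ext a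
    simp [(ℛ ℂ a).convMul_apply])

@[simp] theorem map_apply (φ : R →ₐ[ℂ] S) (f : Fn A R) (a : A) : map φ f a = φ (f a) := rfl

variable (R) in
/-- Functionals, considered as linear maps with constant values in `R`. -/
def cst : Fn A ℂ →ₐ[ℂ] Fn A R := map (Algebra.ofId ℂ R)

@[simp] theorem cst_apply (u : Fn A ℂ) (a : A) : cst R u a = algebraMap ℂ R (u a) := rfl

theorem cst_self (u : Fn A ℂ) : cst ℂ u = u := by ext a; simp

theorem map_cst (φ : R →ₐ[ℂ] S) (u : Fn A ℂ) : map φ (cst R u) = cst S u := by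
  ext a; simp

theorem map_smul (φ : R →ₐ[ℂ] S) (r : R) (f : Fn A R) : map φ (r • f) = φ r • map φ f := by
  ext a; simp

/-- Constant functionals only contribute scalars, so `ℂ`-linearity of `l` suffices. This is what
lets coefficients be extracted from products with Lie algebra elements. -/
theorem comp_mul_cst (l : R →ₗ[ℂ] S) (f : Fn A R) (u : Fn A ℂ) :
    comp l (f * cst R u) = comp l f * cst S u := by
  ext a
  simp only [comp_apply, (ℛ ℂ a).convMul_apply, map_sum, cst_apply]
  refine Finset.sum_congr rfl fun i _ => ?_
  rw [mul_comm, ← Algebra.smul_def, map_smulₛₗ, mul_comm, ← Algebra.smul_def]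
  rfl

theorem comp_cst_mul (l : R →ₗ[ℂ] S) (f : Fn A R) (u : Fn A ℂ) :
    comp l (cst R u * f) = cst S u * comp l f := by
  ext a
  simp only [comp_apply, (ℛ ℂ a).convMul_apply, map_sum, cst_apply]
  refine Finset.sum_congr rfl fun i _ => ?_
  rw [← Algebra.smul_def, map_smulₛₗ, ← Algebra.smul_def]
  rfl

/-- The convolution product is a sum of products of values, so a derivation of the values inherits
the Leibniz rule. All differential equations below rest on it. -/
theorem comp_deriv_mul (D : Derivation ℂ R R) (f g : Fn A R) :
    comp (D : R →ₗ[ℂ] R) (f * g) =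
      comp (D : R →ₗ[ℂ] R) f * g + f * comp (D : R →ₗ[ℂ] R) g := by
  ext a
  change D ((f * g) a) =
    (comp (D : R →ₗ[ℂ] R) f * g) a + (f * comp (D : R →ₗ[ℂ] R) g) a
  simp only [(ℛ ℂ a).convMul_apply, map_sum, comp_apply, ← Finset.sum_add_distrib]
  refine Finset.sum_congr rfl fun i _ => ?_
  rw [Derivation.coeFn_coe, Derivation.leibniz]
  simp only [smul_eq_mul]
  ring

theorem comp_deriv_cst (D : Derivation ℂ R R) (u : Fn A ℂ) :
    comp (D : R →ₗ[ℂ] R) (cst R u) = 0 := by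
  ext a
  change D (algebraMap ℂ R (u a)) = 0
  simp

theorem comp_deriv_smul (D : Derivation ℂ R R) (r : R) (f : Fn A R) :
    comp (D : R →ₗ[ℂ] R) (r • f) = D r • f + r • comp (D : R →ₗ[ℂ] R) f := by
  ext a
  change D (r • f a) = D r • f a + r • D (f a)
  simp only [smul_eq_mul, Derivation.leibniz]
  ring

end Fn

namespace Pts

/-- The linear map underlying a point. -/
def lin : Pts A R →* Fn A R where
  toFun g := toConv g.ofConv.toLinearMap
  map_one' := AlgHom.toLinearMap_convOne
  map_mul' := AlgHom.toLinearMap_convMul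

theorem lin_injective : Function.Injective (lin : Pts A R → Fn A R) := fun _ _ h =>
  ofConv_injective (AlgHom.toLinearMap_injective (toConv_injective h))

@[simp] theorem lin_mul_lin_inv (g : Pts A R) : lin g * lin g⁻¹ = 1 := by
  rw [← map_mul, mul_inv_cancel, map_one]

@[simp] theorem lin_inv_mul_lin (g : Pts A R) : lin g⁻¹ * lin g = 1 := by
  rw [← map_mul, inv_mul_cancel, map_one]

theorem lin_map (φ : R →ₐ[ℂ] S) (g : Pts A R) : lin (map φ g) = Fn.map φ (lin g) := rfl

@[simp] theorem map_mul (φ : R →ₐ[ℂ] S) (g h : Pts A R) : map φ (g * h) = map φ g * map φ h :=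
  lin_injective (by simp only [lin_map, _root_.map_mul])

@[simp] theorem map_one (φ : R →ₐ[ℂ] S) : map φ (1 : Pts A R) = 1 :=
  lin_injective (by simp only [lin_map, _root_.map_one])

@[simp] theorem map_inv (φ : R →ₐ[ℂ] S) (g : Pts A R) : map φ g⁻¹ = (map φ g)⁻¹ :=
  eq_inv_of_mul_eq_one_left (by rw [← map_mul, inv_mul_cancel, map_one])

theorem map_map {Q : Type*} [CommRing Q] [Algebra ℂ Q] (ψ : S →ₐ[ℂ] Q) (φ : R →ₐ[ℂ] S)
    (g : Pts A R) : map ψ (map φ g) = map (ψ.comp φ) g := rfl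

/-- Differentiate `g g⁻¹ = 1`. -/
theorem comp_deriv_inv (D : Derivation ℂ R R) (g : Pts A R) :
    Fn.comp (D : R →ₗ[ℂ] R) (lin g⁻¹) =
      -(lin g⁻¹ * Fn.comp (D : R →ₗ[ℂ] R) (lin g) * lin g⁻¹) := by
  have h := Fn.comp_deriv_mul D (lin g) (lin g⁻¹)
  have h1 : Fn.comp (D : R →ₗ[ℂ] R) (1 : Fn A R) = 0 := by
    rw [← _root_.map_one (Fn.cst R), Fn.comp_deriv_cst]
  rw [lin_mul_lin_inv, h1] at h
  have h2 := congrArg (fun f => lin g⁻¹ * f) h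
  simp only [mul_zero, mul_add, ← mul_assoc, lin_inv_mul_lin, one_mul] at h2
  exact eq_neg_of_add_eq_zero_right h2.symm

end Pts

/-! ### The Lie algebra inside the algebra of functionals -/

namespace LieAlg

/-- The tangent vector at the identity of a left invariant derivation. -/
def fn : LieAlg A →ₗ[ℂ] Fn A ℂ where
  toFun D := toConv ((counit (R := ℂ) (A := A)) ∘ₗ (D.1 : A →ₗ[ℂ] A))
  map_add' D E := by ext a; simp
  map_smul' c D := by ext a; simp

theorem fn_apply (D : LieAlg A) (a : A) : fn D a = counit (R := ℂ) (D.1 a) := rfl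

/-- A left invariant derivation is right convolution with its tangent vector at the identity. Hence
composition of derivations becomes multiplication of functionals, in the same order. -/
theorem comp_apply_eq_mul (f : Fn A ℂ) (D : LieAlg A) (a : A) : f (D.1 a) = (f * fn D) a := by
  rw [apply_eq]
  rw [← (ℛ ℂ a).eq, (ℛ ℂ a).convMul_apply]
  simp only [map_sum, LinearMap.lTensor_tmul, TensorProduct.rid_tmul, map_smul, smul_eq_mul]
  exact Finset.sum_congr rfl fun i _ => mul_comm _ _

theorem fn_injective : Function.Injective (fn : LieAlg A → Fn A ℂ) := by
  intro D E h
  apply Subtype.ext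
  ext a
  rw [apply_eq D, apply_eq E]
  have h' : (counit (R := ℂ) (A := A)) ∘ₗ (D.1 : A →ₗ[ℂ] A) =
    (counit (R := ℂ) (A := A)) ∘ₗ (E.1 : A →ₗ[ℂ] A) := congrArg ofConv h
  rw [h']

theorem fn_lie (D E : LieAlg A) : fn ⁅D, E⁆ = fn D * fn E - fn E * fn D := by
  ext a
  change counit (R := ℂ) ((⁅D, E⁆ : LieAlg A).1 a) = (fn D * fn E) a - (fn E * fn D) a
  rw [← comp_apply_eq_mul, ← comp_apply_eq_mul, LieSubalgebra.coe_bracket,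
    Derivation.commutator_apply, map_sub]
  rfl

theorem counit_iterate (D : LieAlg A) (n : ℕ) (a : A) :
    counit (R := ℂ) ((D.1 : A →ₗ[ℂ] A)^[n] a) = (fn D ^ n) a := by
  induction n generalizing a with
  | zero => simp
  | succ n ih =>
    rw [Function.iterate_succ_apply, ih, pow_succ]
    exact comp_apply_eq_mul _ D a

end LieAlg

/-! ### The exponential curves -/

section exp

variable (x : LieAlg A) (hx : LocNilp x)

theorem comp_lcoeff_expCurve (n : ℕ) :
    Fn.comp (Polynomial.lcoeff ℂ n) (Pts.lin (expCurve x hx)) =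
      (n.factorial : ℂ)⁻¹ • LieAlg.fn x ^ n := by
  ext a
  change (expFun x hx a).coeff n = (n.factorial : ℂ)⁻¹ • (LieAlg.fn x ^ n) a
  rw [coeff_expFun, LieAlg.counit_iterate, smul_eq_mul]

theorem Fn.ext_lcoeff {f g : Fn A ℂ[X]}
    (h : ∀ n, Fn.comp (Polynomial.lcoeff ℂ n) f = Fn.comp (Polynomial.lcoeff ℂ n) g) : f = g := by
  ext a n
  exact congrArg (fun u : Fn A ℂ => u a) (h n)

/-- The derivation `d/ds` of `ℂ[s]`. -/
abbrev polyDeriv : Derivation ℂ ℂ[X] ℂ[X] := Polynomial.derivative'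

theorem comp_lcoeff_polyDeriv (f : Fn A ℂ[X]) (n : ℕ) :
    Fn.comp (Polynomial.lcoeff ℂ n) (Fn.comp (polyDeriv : ℂ[X] →ₗ[ℂ] ℂ[X]) f) =
      ((n : ℂ) + 1) • Fn.comp (Polynomial.lcoeff ℂ (n + 1)) f := by
  ext a
  change (Polynomial.derivative (f a)).coeff n = ((n : ℂ) + 1) • (f a).coeff (n + 1)
  rw [Polynomial.coeff_derivative, smul_eq_mul, mul_comm]

/-- Compare coefficients of `s^n`: the claim becomes `(n + 1) / (n + 1)! = 1 / n!`. -/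
theorem polyDeriv_expCurve :
    Fn.comp (polyDeriv : ℂ[X] →ₗ[ℂ] ℂ[X]) (Pts.lin (expCurve x hx)) =
      Fn.cst ℂ[X] (LieAlg.fn x) * Pts.lin (expCurve x hx) := by
  apply Fn.ext_lcoeff
  intro n
  rw [comp_lcoeff_polyDeriv, Fn.comp_cst_mul, comp_lcoeff_expCurve, comp_lcoeff_expCurve,
    Fn.cst_self, mul_smul_comm, ← pow_succ', smul_smul]
  congr 1
  rw [Nat.factorial_succ]
  have h1 : (n.factorial : ℂ) ≠ 0 := by exact_mod_cast n.factorial_ne_zero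
  have h2 : (n : ℂ) + 1 ≠ 0 := by exact_mod_cast n.succ_ne_zero
  push_cast
  field_simp

theorem expCurve_commute :
    Commute (Fn.cst ℂ[X] (LieAlg.fn x)) (Pts.lin (expCurve x hx)) := by
  apply Fn.ext_lcoeff
  intro n
  rw [Fn.comp_cst_mul, Fn.comp_mul_cst, comp_lcoeff_expCurve,
    Fn.cst_self, mul_smul_comm, smul_mul_assoc, ← pow_succ', ← pow_succ]

/-- In characteristic zero the derivative determines every coefficient except the constant one. This
is the uniqueness principle used to compute adjoint actions. -/
theorem Fn.ext_polyDeriv {f g : Fn A ℂ[X]}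
    (h : Fn.comp (polyDeriv : ℂ[X] →ₗ[ℂ] ℂ[X]) f = Fn.comp (polyDeriv : ℂ[X] →ₗ[ℂ] ℂ[X]) g)
    (h0 : Fn.comp (Polynomial.lcoeff ℂ 0) f = Fn.comp (Polynomial.lcoeff ℂ 0) g) : f = g := by
  apply Fn.ext_lcoeff
  intro n
  cases n with
  | zero => exact h0
  | succ n =>
    have := congrArg (Fn.comp (Polynomial.lcoeff ℂ n)) h
    rw [comp_lcoeff_polyDeriv, comp_lcoeff_polyDeriv] at this
    have h2 : (n : ℂ) + 1 ≠ 0 := by exact_mod_cast n.succ_ne_zero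
    exact smul_right_injective _ h2 this

/-- `Ad(exp(-s x)) u`. -/
def adExp (u : Fn A ℂ) : Fn A ℂ[X] :=
  Pts.lin (expCurve x hx)⁻¹ * Fn.cst ℂ[X] u * Pts.lin (expCurve x hx)

theorem cst_mul_expCurve (u : Fn A ℂ) :
    Fn.cst ℂ[X] u * Pts.lin (expCurve x hx) = Pts.lin (expCurve x hx) * adExp x hx u := by
  rw [adExp, ← mul_assoc, ← mul_assoc, Pts.lin_mul_lin_inv, one_mul]

/-- Differentiating the two outer factors produces `-x` on the left and `x` on the right of `u`,
because `x` commutes with its own exponential. -/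
theorem polyDeriv_adExp (u : Fn A ℂ) :
    Fn.comp (polyDeriv : ℂ[X] →ₗ[ℂ] ℂ[X]) (adExp x hx u) =
      adExp x hx (u * LieAlg.fn x - LieAlg.fn x * u) := by
  have hc := (expCurve_commute x hx).eq
  have hc' : Pts.lin (expCurve x hx)⁻¹ * Fn.cst ℂ[X] (LieAlg.fn x) * Pts.lin (expCurve x hx) *
      Pts.lin (expCurve x hx)⁻¹ = Pts.lin (expCurve x hx)⁻¹ * Fn.cst ℂ[X] (LieAlg.fn x) := by
    rw [mul_assoc _ (Pts.lin _), Pts.lin_mul_lin_inv, mul_one]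
  rw [adExp, Fn.comp_deriv_mul, Fn.comp_deriv_mul, Fn.comp_deriv_cst, Pts.comp_deriv_inv,
    polyDeriv_expCurve, adExp, map_sub, map_mul, map_mul]
  rw [← mul_assoc, hc']
  noncomm_ring

theorem comp_lcoeff_zero (f : Fn A ℂ[X]) :
    Fn.comp (Polynomial.lcoeff ℂ 0) f = Fn.map (Polynomial.aeval (0 : ℂ)) f := by
  ext a
  change (f a).coeff 0 = Polynomial.aeval (0 : ℂ) (f a)
  rw [Polynomial.coeff_zero_eq_aeval_zero]

theorem adExp_zero (u : Fn A ℂ) :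
    Fn.comp (Polynomial.lcoeff ℂ 0) (adExp x hx u) = u := by
  have h1 : Fn.map (Polynomial.aeval (0 : ℂ)) (Pts.lin (expCurve x hx)) = 1 := by
    rw [← comp_lcoeff_zero, comp_lcoeff_expCurve]; simp
  have h2 : Fn.map (Polynomial.aeval (0 : ℂ)) (Pts.lin (expCurve x hx)⁻¹) = 1 := by
    rw [← Pts.lin_map, Pts.map_inv]
    have : Pts.map (Polynomial.aeval (0 : ℂ)) (expCurve x hx) = 1 := Pts.lin_injective (by
      rw [Pts.lin_map, h1, map_one])
    rw [this, inv_one, map_one]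
  rw [comp_lcoeff_zero, adExp, map_mul, map_mul, h1, h2, Fn.map_cst, Fn.cst_self, one_mul, mul_one]

theorem adExp_self : adExp x hx (LieAlg.fn x) = Fn.cst ℂ[X] (LieAlg.fn x) := by
  rw [adExp, mul_assoc, (expCurve_commute x hx).eq, ← mul_assoc, Pts.lin_inv_mul_lin, one_mul]

theorem adExp_neg (u : Fn A ℂ) : adExp x hx (-u) = -adExp x hx u := by
  simp [adExp]

theorem adExp_smul (c : ℂ) (u : Fn A ℂ) : adExp x hx (c • u) = c • adExp x hx u := by
  simp [adExp]

theorem comp_lcoeff_zero_cst (u : Fn A ℂ) :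
    Fn.comp (Polynomial.lcoeff ℂ 0) (Fn.cst ℂ[X] u) = u := by
  rw [comp_lcoeff_zero, Fn.map_cst, Fn.cst_self]

/-! ### The adjoint action of an exponential on an `𝔰𝔩₂`-triple -/

variable {x} {h y : LieAlg A}

/-- Since `[h, x] = 2x` and `x` is fixed by the action, the derivative in `s` is the constant `2x`;
integrate from the value `h` at `s = 0`. -/
theorem adExp_h (ht : IsSl2Triple h x y) : adExp x hx (LieAlg.fn h) = Fn.cst ℂ[X] (LieAlg.fn h) +
    ((2 : ℂ) • (Polynomial.X : ℂ[X])) • Fn.cst ℂ[X] (LieAlg.fn x) := by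
  apply Fn.ext_polyDeriv
  · rw [polyDeriv_adExp, ← LieAlg.fn_lie, ht.lie_h_e_smul ℂ, map_smul, adExp_smul, adExp_self,
      map_add, Fn.comp_deriv_cst, Fn.comp_deriv_smul, Fn.comp_deriv_cst]
    ext a
    simp [polyDeriv, Polynomial.smul_eq_C_mul]
  · rw [adExp_zero, map_add, comp_lcoeff_zero_cst, comp_lcoeff_zero, Fn.map_smul]
    simp

/-- Since `[y, x] = -h`, the derivative is minus the curve of `adExp_h`, that is `-h - 2s x`;
integrate from the value `y`. -/
theorem adExp_f (ht : IsSl2Triple h x y) : adExp x hx (LieAlg.fn y) = Fn.cst ℂ[X] (LieAlg.fn y) -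
    (Polynomial.X : ℂ[X]) • Fn.cst ℂ[X] (LieAlg.fn h) -
    ((Polynomial.X : ℂ[X]) ^ 2) • Fn.cst ℂ[X] (LieAlg.fn x) := by
  apply Fn.ext_polyDeriv
  · rw [polyDeriv_adExp, ← LieAlg.fn_lie, ← lie_skew, ht.lie_e_f, map_neg, adExp_neg,
      adExp_h hx ht, map_sub, map_sub, Fn.comp_deriv_cst, Fn.comp_deriv_smul, Fn.comp_deriv_smul,
      Fn.comp_deriv_cst, Fn.comp_deriv_cst]
    ext a
    simp [polyDeriv, Polynomial.smul_eq_C_mul]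
    ring_nf
  · rw [adExp_zero, map_sub, map_sub, comp_lcoeff_zero_cst, comp_lcoeff_zero, comp_lcoeff_zero,
      Fn.map_smul, Fn.map_smul]
    simp

end exp

end HeckeP1
end

noncomputable section

namespace HeckeP1

variable {A : Type u} [CommRing A] [HopfAlgebra ℂ A]
variable {R S : Type*} [CommRing R] [Algebra ℂ R] [CommRing S] [Algebra ℂ S]

/-! ### Laurent polynomials -/

namespace Laurent

open LaurentPolynomial

theorem linearMap_ext {M : Type*} [AddCommGroup M] [Module ℂ M] {l l' : ℂ[T;T⁻¹] →ₗ[ℂ] M}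
    (h : ∀ n, l (T n) = l' (T n)) : l = l' := by
  refine LinearMap.ext fun f => ?_
  induction f using AddMonoidAlgebra.induction_linear with
  | zero => simp
  | add f g hf hg => rw [map_add, map_add, hf, hg]
  | single n c =>
    have : (AddMonoidAlgebra.single n c : ℂ[T;T⁻¹]) = c • T n := by
      rw [single_eq_C_mul_T, smul_eq_C_mul]
    rw [this, map_smul, map_smul, h]

/-- The coefficient of `Tⁿ`. -/
def coeffL (n : ℤ) : ℂ[T;T⁻¹] →ₗ[ℂ] ℂ :=
  Finsupp.lapply n ∘ₗ (AddMonoidAlgebra.coeffLinearEquiv ℂ).toLinearMap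

theorem coeffL_apply (n : ℤ) (f : ℂ[T;T⁻¹]) : coeffL n f = f.coeff n := rfl

theorem coeffL_T (n m : ℤ) : coeffL n (T m) = if m = n then 1 else 0 := by
  rw [coeffL_apply, T, AddMonoidAlgebra.coeff_single, Finsupp.single_apply]

theorem ext_coeffL {f g : ℂ[T;T⁻¹]} (h : ∀ n, coeffL n f = coeffL n g) : f = g := by
  apply AddMonoidAlgebra.ext
  exact Finsupp.ext h

/-- The linear map underlying `T d/dT`. -/
def thetaL : ℂ[T;T⁻¹] →ₗ[ℂ] ℂ[T;T⁻¹] :=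
  (AddMonoidAlgebra.coeffLinearEquiv ℂ).symm.toLinearMap ∘ₗ
    Finsupp.lsum ℂ (fun n : ℤ => (n : ℂ) • Finsupp.lsingle n) ∘ₗ
      (AddMonoidAlgebra.coeffLinearEquiv ℂ).toLinearMap

theorem thetaL_T (n : ℤ) : thetaL (T n) = (n : ℂ) • T n := by
  rw [T, thetaL, LinearMap.comp_apply, LinearMap.comp_apply, LinearEquiv.coe_coe,
    LinearEquiv.coe_coe, LinearEquiv.symm_apply_eq, map_smul]
  change Finsupp.lsum ℂ _ (Finsupp.single n (1 : ℂ)) = (n : ℂ) • Finsupp.single n (1 : ℂ)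
  rw [Finsupp.lsum_single, LinearMap.smul_apply, Finsupp.lsingle_apply]

/-- The derivation `T d/dT` of `ℂ[T, T⁻¹]`. -/
def theta : Derivation ℂ ℂ[T;T⁻¹] ℂ[T;T⁻¹] :=
  Derivation.mk' thetaL (by
    have key : (LinearMap.mul ℂ ℂ[T;T⁻¹]).compr₂ thetaL =
        (LinearMap.mul ℂ ℂ[T;T⁻¹]).compl₂ thetaL + (LinearMap.mul ℂ ℂ[T;T⁻¹]) ∘ₗ thetaL := by
      apply linearMap_ext
      intro n
      apply linearMap_ext
      intro m
      simp only [LinearMap.compr₂_apply, LinearMap.mul_apply', LinearMap.add_apply,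
        LinearMap.compl₂_apply, LinearMap.comp_apply, thetaL_T, ← T_add, mul_smul_comm,
        smul_mul_assoc, ← add_smul]
      push_cast
      rw [add_comm]
    intro a b
    have := congrArg (fun l => l a b) key
    simp only [LinearMap.compr₂_apply, LinearMap.mul_apply', LinearMap.add_apply,
        LinearMap.compl₂_apply, LinearMap.comp_apply] at this
    rw [this, smul_eq_mul, smul_eq_mul, mul_comm b])

theorem theta_T (n : ℤ) : theta (T n) = (n : ℂ) • T n := thetaL_T n

theorem coeffL_theta (n : ℤ) (f : ℂ[T;T⁻¹]) : coeffL n (theta f) = (n : ℂ) * coeffL n f := by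
  have : coeffL n ∘ₗ (theta : ℂ[T;T⁻¹] →ₗ[ℂ] ℂ[T;T⁻¹]) = (n : ℂ) • coeffL n := by
    apply linearMap_ext
    intro m
    simp only [LinearMap.comp_apply, Derivation.coeFn_coe, theta_T, map_smul, LinearMap.smul_apply,
      coeffL_T]
    split_ifs with h
    · rw [h]
    · simp
  exact congrArg (fun l => l f) this

/-- Substitution of a unit for `T`. -/
def evalUnit (u : Sˣ) : ℂ[T;T⁻¹] →ₐ[ℂ] S :=
  AddMonoidAlgebra.lift ℂ S ℤ ((Units.coeHom S).comp (zpowersHom Sˣ u))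

theorem evalUnit_T (u : Sˣ) (n : ℤ) : evalUnit u (T n) = ((u ^ n : Sˣ) : S) := by
  rw [evalUnit, T, AddMonoidAlgebra.lift_single, one_smul]
  rfl

theorem algHom_ext {φ ψ : ℂ[T;T⁻¹] →ₐ[ℂ] S} (h : ∀ n, φ (T n) = ψ (T n)) : φ = ψ :=
  AlgHom.toLinearMap_injective (linearMap_ext h)

/-- Evaluation at `T = 1`. -/
abbrev evalOne : ℂ[T;T⁻¹] →ₐ[ℂ] ℂ := evalUnit 1

theorem evalOne_T (n : ℤ) : evalOne (T n) = 1 := by simp [evalUnit_T]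

theorem derivOne_eq (f : ℂ[T;T⁻¹]) : derivOne f = evalOne (theta f) := by
  have h : Finsupp.lsum ℂ (fun n : ℤ => (n : ℂ) • (LinearMap.id : ℂ →ₗ[ℂ] ℂ)) ∘ₗ
      (AddMonoidAlgebra.coeffLinearEquiv ℂ).toLinearMap =
      evalOne.toLinearMap ∘ₗ (theta : ℂ[T;T⁻¹] →ₗ[ℂ] ℂ[T;T⁻¹]) := by
    apply linearMap_ext
    intro n
    rw [LinearMap.comp_apply, LinearMap.comp_apply, Derivation.coeFn_coe, theta_T, map_smul,
      AlgHom.toLinearMap_apply, evalOne_T]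
    change Finsupp.lsum ℂ _ (Finsupp.single n (1 : ℂ)) = _
    rw [Finsupp.lsum_single, LinearMap.smul_apply, LinearMap.id_apply]
  refine Eq.trans ?_ (congrArg (fun l => l f) h)
  rfl

theorem counit_eq (f : ℂ[T;T⁻¹]) : counit (R := ℂ) f = evalOne f := by
  have h : (counit : ℂ[T;T⁻¹] →ₗ[ℂ] ℂ) = evalOne.toLinearMap := by
    apply linearMap_ext
    intro n
    simp [evalOne_T]
  exact congrArg (fun l => l f) h

theorem comul_T (n : ℤ) : comul (R := ℂ) (T n : ℂ[T;T⁻¹]) = T n ⊗ₜ T n := by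
  simp

/-- The powers of `T` in the second factor form a basis, so a tensor is a finitely supported family
of coefficients in the first factor. -/
theorem tensor_ext {w w' : ℂ[T;T⁻¹] ⊗[ℂ] ℂ[T;T⁻¹]}
    (h : ∀ n, (coeffL n).lTensor ℂ[T;T⁻¹] w = (coeffL n).lTensor ℂ[T;T⁻¹] w') : w = w' := by
  classical
  have hinj : Function.Injective ((AddMonoidAlgebra.coeffLinearEquiv ℂ
      (S := ℂ) (M := ℤ)).toLinearMap.lTensor ℂ[T;T⁻¹]) :=
    ((AddMonoidAlgebra.coeffLinearEquiv ℂ (S := ℂ) (M := ℤ)).lTensor ℂ[T;T⁻¹]).injective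
  apply hinj
  apply (TensorProduct.finsuppScalarRight ℂ ℂ ℂ[T;T⁻¹] ℤ).injective
  ext1 n
  rw [TensorProduct.finsuppScalarRight_apply, TensorProduct.finsuppScalarRight_apply,
    ← LinearMap.comp_apply, ← LinearMap.comp_apply, ← LinearMap.lTensor_comp]
  exact congrArg _ (h n)

/-- `Tⁿ` as a unit. -/
def unitT (n : ℤ) : (ℂ[T;T⁻¹])ˣ where
  val := T n
  inv := T (-n)
  val_inv := by rw [← T_add]; simp
  inv_val := by rw [← T_add]; simp

theorem evalUnit_unitT_one : evalUnit (unitT 1) = AlgHom.id ℂ ℂ[T;T⁻¹] := by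
  apply algHom_ext
  intro n
  have : ∀ n : ℤ, unitT 1 ^ n = unitT n := by
    intro n
    induction n using Int.induction_on with
    | zero => ext1; exact (T_zero).symm
    | succ n ih => rw [zpow_add_one, ih]; ext1; exact (T_add _ _).symm
    | pred n ih =>
      rw [zpow_sub_one, ih]; ext1; exact (T_sub _ _).symm
  rw [evalUnit_T, this]
  rfl

end Laurent

open Laurent
open LaurentPolynomial (T)

/-! ### Homogeneous components and eigenvectors of `T d/dT` -/

namespace Fn

instance : IsScalarTower ℂ R (Fn A R) := ⟨fun c r f => by ext a; simp⟩

instance : SMulCommClass ℂ R (Fn A R) := ⟨fun c r f => by ext a; simp⟩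

theorem ext_coeffL {f g : Fn A ℂ[T;T⁻¹]} (h : ∀ n, comp (coeffL n) f = comp (coeffL n) g) :
    f = g := by
  ext1
  refine LinearMap.ext fun a => ?_
  exact Laurent.ext_coeffL fun n => congrArg (fun u : Fn A ℂ => u a) (h n)

/-- The action of `T d/dT`. -/
abbrev theta : Fn A ℂ[T;T⁻¹] →ₗ[ℂ] Fn A ℂ[T;T⁻¹] :=
  comp (Laurent.theta : ℂ[T;T⁻¹] →ₗ[ℂ] ℂ[T;T⁻¹])

theorem comp_coeffL_theta (n : ℤ) (f : Fn A ℂ[T;T⁻¹]) :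
    comp (coeffL n) (theta f) = (n : ℂ) • comp (coeffL n) f := by
  ext a
  exact coeffL_theta n (f a)

theorem comp_coeffL_T_smul_cst (n m : ℤ) (u : Fn A ℂ) :
    comp (coeffL n) ((T m : ℂ[T;T⁻¹]) • cst ℂ[T;T⁻¹] u) = if m = n then u else 0 := by
  ext a
  change coeffL n (T m * algebraMap ℂ ℂ[T;T⁻¹] (u a)) = (if m = n then u else 0) a
  rw [mul_comm, ← Algebra.smul_def, _root_.map_smul, coeffL_T]
  split_ifs <;> simp

theorem map_evalOne_T_smul_cst (m : ℤ) (u : Fn A ℂ) :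
    map evalOne ((T m : ℂ[T;T⁻¹]) • cst ℂ[T;T⁻¹] u) = u := by
  rw [map_smul, map_cst, cst_self, evalOne_T, one_smul]

/-- Only the `T^k` component survives, and evaluation at `T = 1` reads off its coefficient. -/
theorem eq_T_smul_cst {f : Fn A ℂ[T;T⁻¹]} {k : ℤ}
    (h : ∀ n, n ≠ k → comp (coeffL n) f = 0) :
    f = (T k : ℂ[T;T⁻¹]) • cst ℂ[T;T⁻¹] (map evalOne f) := by
  have h1 : f = (T k : ℂ[T;T⁻¹]) • cst ℂ[T;T⁻¹] (comp (coeffL k) f) := by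
    apply ext_coeffL
    intro n
    rw [comp_coeffL_T_smul_cst]
    split_ifs with hn
    · rw [hn]
    · exact h n (Ne.symm hn)
  have h2 : map evalOne f = comp (coeffL k) f := by
    conv_lhs => rw [h1]
    rw [map_evalOne_T_smul_cst]
  rw [h2]
  exact h1

/-- The coefficient `f_n` satisfies `n f_n = c f_n`. This is the source of integrality of weights: a
nonzero eigenvector has some nonzero coefficient. -/
theorem comp_coeffL_eq_zero {f : Fn A ℂ[T;T⁻¹]} {c : ℂ} (h : theta f = c • f) {n : ℤ}
    (hn : (n : ℂ) ≠ c) : comp (coeffL n) f = 0 := by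
  have h1 := congrArg (comp (coeffL n)) h
  rw [comp_coeffL_theta, _root_.map_smul, ← sub_eq_zero, ← sub_smul] at h1
  exact (smul_eq_zero.1 h1).resolve_left (sub_ne_zero.2 hn)

theorem eq_T_smul_cst_of_theta {f : Fn A ℂ[T;T⁻¹]} {k : ℤ} (h : theta f = (k : ℂ) • f) :
    f = (T k : ℂ[T;T⁻¹]) • cst ℂ[T;T⁻¹] (map evalOne f) :=
  eq_T_smul_cst fun n hn => comp_coeffL_eq_zero h (by exact_mod_cast hn)

theorem exists_int_of_theta {f : Fn A ℂ[T;T⁻¹]} {c : ℂ} (h : theta f = c • f) (hf : f ≠ 0) :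
    ∃ k : ℤ, (k : ℂ) = c := by
  by_contra hc
  push Not at hc
  apply hf
  apply ext_coeffL
  intro n
  rw [comp_coeffL_eq_zero h (hc n), map_zero]

theorem eq_cst_of_theta_eq_zero {f : Fn A ℂ[T;T⁻¹]} (h : theta f = 0) :
    f = cst ℂ[T;T⁻¹] (map evalOne f) := by
  have := eq_T_smul_cst_of_theta (f := f) (k := 0) (by simpa using h)
  simpa using this

end Fn

/-! ### Cocharacters -/

/-- `φ ∈ G(ℂ[T, T⁻¹])` is the cocharacter with derivative `v`. -/
structure IsCochar (φ : Pts A ℂ[T;T⁻¹]) (v : Fn A ℂ) : Prop where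
  theta_eq : Fn.theta (Pts.lin φ) = Fn.cst ℂ[T;T⁻¹] v * Pts.lin φ
  map_one : Pts.map evalOne φ = 1

namespace IsCochar

variable {φ ψ : Pts A ℂ[T;T⁻¹]} {v w : Fn A ℂ}

theorem map_evalOne (h : IsCochar φ v) : Fn.map evalOne (Pts.lin φ) = 1 := by
  rw [← Pts.lin_map, h.map_one, _root_.map_one]

theorem theta_inv (h : IsCochar φ v) :
    Fn.theta (Pts.lin φ⁻¹) = -(Pts.lin φ⁻¹ * Fn.cst ℂ[T;T⁻¹] v) := by
  rw [Fn.theta, Pts.comp_deriv_inv]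
  have := h.theta_eq
  rw [Fn.theta] at this
  rw [this, mul_assoc, mul_assoc, Pts.lin_mul_lin_inv, mul_one]

/-- Variation of constants: `φ⁻¹ f` has derivative zero, so it is constant and equal to its value at
`T = 1`, which vanishes. -/
theorem eq_zero_of_theta (h : IsCochar φ v) {f : Fn A ℂ[T;T⁻¹]}
    (hf : Fn.theta f = Fn.cst ℂ[T;T⁻¹] v * f) (h1 : Fn.map evalOne f = 0) : f = 0 := by
  have h2 : Fn.theta (Pts.lin φ⁻¹ * f) = 0 := by
    have := Fn.comp_deriv_mul Laurent.theta (Pts.lin φ⁻¹) f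
    rw [Fn.theta] at hf ⊢
    have h3 := h.theta_inv
    rw [Fn.theta] at h3
    rw [this, hf, h3]
    noncomm_ring
  have h3 := Fn.eq_cst_of_theta_eq_zero h2
  rw [_root_.map_mul, h1, mul_zero, map_zero] at h3
  have h4 := congrArg (fun g => Pts.lin φ * g) h3
  simpa [← mul_assoc] using h4

/-- The component of weight `n`. -/
def component (φ : Pts A ℂ[T;T⁻¹]) (n : ℤ) : Fn A ℂ := Fn.comp (coeffL n) (Pts.lin φ)

theorem mul_component (h : IsCochar φ v) (n : ℤ) : v * component φ n = (n : ℂ) • component φ n := by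
  have := congrArg (Fn.comp (coeffL n)) h.theta_eq
  rw [Fn.comp_coeffL_theta, Fn.comp_cst_mul, Fn.cst_self] at this
  exact this.symm

/-- Write `φ = ∑ T^n φ_n`, where `v φ_n = n φ_n`. Both sides solve `θ f = v f` and take the value
`φ_n` at `T = 1`, so uniqueness applies. -/
theorem lin_mul_component (h : IsCochar φ v) (n : ℤ) :
    Pts.lin φ * Fn.cst ℂ[T;T⁻¹] (component φ n) =
      (T n : ℂ[T;T⁻¹]) • Fn.cst ℂ[T;T⁻¹] (component φ n) := by
  rw [← sub_eq_zero]
  apply h.eq_zero_of_theta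
  · have h1 := h.theta_eq
    rw [Fn.theta] at h1
    rw [Fn.theta, map_sub, Fn.comp_deriv_mul, Fn.comp_deriv_smul, Fn.comp_deriv_cst, h1,
      theta_T, mul_zero, add_zero, smul_zero, add_zero, mul_sub, mul_assoc, mul_smul_comm,
      ← _root_.map_mul (Fn.cst _) v, h.mul_component, map_smul, smul_assoc,
      smul_comm (n : ℂ) (T n : ℂ[T;T⁻¹])]
  · rw [map_sub, Fn.map_evalOne_T_smul_cst, _root_.map_mul, h.map_evalOne, Fn.map_cst, Fn.cst_self,
      one_mul, sub_self]

/-- Coefficients of `φ φ_m = T^m φ_m`: the weight components are orthogonal idempotents. -/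
theorem component_mul_component (h : IsCochar φ v) (n m : ℤ) :
    component φ n * component φ m = if n = m then component φ n else 0 := by
  have := congrArg (Fn.comp (coeffL n)) (h.lin_mul_component m)
  rw [Fn.comp_mul_cst, Fn.comp_coeffL_T_smul_cst, Fn.cst_self] at this
  refine this.trans ?_
  by_cases hnm : n = m
  · simp [hnm]
  · rw [if_neg hnm, if_neg (Ne.symm hnm)]

theorem component_mul_lin (h : IsCochar φ v) (n : ℤ) :
    Fn.cst ℂ[T;T⁻¹] (component φ n) * Pts.lin φ =
      (T n : ℂ[T;T⁻¹]) • Fn.cst ℂ[T;T⁻¹] (component φ n) := by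
  apply Fn.ext_coeffL
  intro m
  rw [Fn.comp_cst_mul, Fn.comp_coeffL_T_smul_cst, Fn.cst_self]
  exact h.component_mul_component n m

theorem evalOne_theta (h : IsCochar φ v) : Fn.map evalOne (Fn.theta (Pts.lin φ)) = v := by
  rw [h.theta_eq, _root_.map_mul, h.map_evalOne, Fn.map_cst, Fn.cst_self, mul_one]

/-- The defining equation controls `v` only from the left. Orthogonality gives `φ_n φ = T^n φ_n`;
differentiating this at `T = 1` gives the eigenvalue equation from the right. -/
theorem component_mul (h : IsCochar φ v) (n : ℤ) : component φ n * v = (n : ℂ) • component φ n := by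
  have := congrArg (fun f => Fn.map evalOne (Fn.theta f)) (h.component_mul_lin n)
  simp only [Fn.theta] at this
  rw [Fn.comp_cst_mul, Fn.comp_deriv_smul, Fn.comp_deriv_cst, smul_zero, add_zero, theta_T,
    smul_assoc, map_smul, Fn.map_evalOne_T_smul_cst, _root_.map_mul, Fn.map_cst, Fn.cst_self] at this
  have h2 := h.evalOne_theta
  rw [Fn.theta] at h2
  rwa [h2] at this

theorem commute_lin (h : IsCochar φ v) : Commute (Fn.cst ℂ[T;T⁻¹] v) (Pts.lin φ) := by
  apply Fn.ext_coeffL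
  intro n
  rw [Fn.comp_cst_mul, Fn.comp_mul_cst, Fn.cst_self]
  exact (h.mul_component n).trans (h.component_mul n).symm

/-- The derivative of `φ w φ⁻¹` is `φ [v, w] φ⁻¹`, since `v` commutes with `φ` and `φ⁻¹`. -/
theorem theta_conj (h : IsCochar φ v) {c : ℂ} (hw : v * w - w * v = c • w) :
    Fn.theta (Pts.lin φ * Fn.cst ℂ[T;T⁻¹] w * Pts.lin φ⁻¹) =
      c • (Pts.lin φ * Fn.cst ℂ[T;T⁻¹] w * Pts.lin φ⁻¹) := by
  have h1 := h.theta_eq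
  have h2 := h.theta_inv
  rw [h.commute_lin.eq] at h1
  have h3 : Pts.lin φ⁻¹ * Fn.cst ℂ[T;T⁻¹] v = Fn.cst ℂ[T;T⁻¹] v * Pts.lin φ⁻¹ := by
    have := congrArg (fun f => Pts.lin φ⁻¹ * f * Pts.lin φ⁻¹) h.commute_lin.eq
    simp only [mul_assoc, Pts.lin_mul_lin_inv, mul_one] at this
    rwa [← mul_assoc (Pts.lin φ⁻¹) (Pts.lin φ), Pts.lin_inv_mul_lin, one_mul] at this
  rw [h3] at h2
  rw [Fn.theta] at h1 h2 ⊢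
  rw [Fn.comp_deriv_mul, Fn.comp_deriv_mul, Fn.comp_deriv_cst, h1, h2]
  have h4 : c • (Pts.lin φ * Fn.cst ℂ[T;T⁻¹] w * Pts.lin φ⁻¹) =
      Pts.lin φ * Fn.cst ℂ[T;T⁻¹] (c • w) * Pts.lin φ⁻¹ := by
    rw [map_smul, mul_smul_comm, smul_mul_assoc]
  rw [h4, ← hw, map_sub, _root_.map_mul, _root_.map_mul]
  noncomm_ring

theorem map_evalOne_conj (h : IsCochar φ v) :
    Fn.map evalOne (Pts.lin φ * Fn.cst ℂ[T;T⁻¹] w * Pts.lin φ⁻¹) = w := by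
  rw [_root_.map_mul, _root_.map_mul, h.map_evalOne, Fn.map_cst, Fn.cst_self, ← Pts.lin_map,
    Pts.map_inv, h.map_one, inv_one, _root_.map_one, one_mul, mul_one]

/-- Weights of a cocharacter are integers. -/
theorem exists_int (h : IsCochar φ v) {c : ℂ} (hw : v * w - w * v = c • w) (hw0 : w ≠ 0) :
    ∃ k : ℤ, (k : ℂ) = c := by
  refine Fn.exists_int_of_theta (h.theta_conj hw) fun h0 => hw0 ?_
  rw [← h.map_evalOne_conj (w := w), h0, map_zero]

/-- The conjugate `φ w φ⁻¹` is an eigenvector of `θ` with eigenvalue `k` and value `w` at `T = 1`,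
hence equals `T^k w`. -/
theorem lin_mul_cst (h : IsCochar φ v) {k : ℤ} (hw : v * w - w * v = (k : ℂ) • w) :
    Pts.lin φ * Fn.cst ℂ[T;T⁻¹] w = (T k : ℂ[T;T⁻¹]) • (Fn.cst ℂ[T;T⁻¹] w * Pts.lin φ) := by
  have h1 := Fn.eq_T_smul_cst_of_theta (h.theta_conj hw)
  rw [h.map_evalOne_conj] at h1
  have h2 := congrArg (fun f => f * Pts.lin φ) h1
  rwa [mul_assoc, Pts.lin_inv_mul_lin, mul_one, smul_mul_assoc] at h2

theorem commute_of_commute (h : IsCochar φ v) (hw : Commute v w) :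
    Commute (Pts.lin φ) (Fn.cst ℂ[T;T⁻¹] w) := by
  have := h.lin_mul_cst (w := w) (k := 0) (by rw [hw.eq]; simp)
  rwa [LaurentPolynomial.T_zero, one_smul] at this

/-- Commutation of `v` and `w` lets `w` pass to the left of `φ` in the Leibniz rule. -/
theorem mul (h : IsCochar φ v) (h' : IsCochar ψ w) (hvw : Commute v w) :
    IsCochar (φ * ψ) (v + w) where
  theta_eq := by
    have h1 := h.theta_eq
    have h2 := h'.theta_eq
    rw [Fn.theta] at h1 h2 ⊢
    rw [_root_.map_mul, Fn.comp_deriv_mul, h1, h2, ← mul_assoc, (h.commute_of_commute hvw).eq,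
      map_add]
    noncomm_ring
  map_one := by rw [Pts.map_mul, h.map_one, h'.map_one, one_mul]

theorem inv (h : IsCochar φ v) : IsCochar φ⁻¹ (-v) where
  theta_eq := by
    rw [h.theta_inv, map_neg, neg_mul]
    have := congrArg (fun f => Pts.lin φ⁻¹ * f * Pts.lin φ⁻¹) h.commute_lin.eq
    simp only [mul_assoc, Pts.lin_mul_lin_inv, mul_one] at this
    rw [← mul_assoc (Pts.lin φ⁻¹) (Pts.lin φ), Pts.lin_inv_mul_lin, one_mul] at this
    rw [this]
  map_one := by rw [Pts.map_inv, h.map_one, inv_one]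

theorem one : IsCochar (1 : Pts A ℂ[T;T⁻¹]) 0 where
  theta_eq := by
    rw [_root_.map_one, ← _root_.map_one (Fn.cst ℂ[T;T⁻¹]), Fn.theta, Fn.comp_deriv_cst]
    simp
  map_one := Pts.map_one _

theorem pow (h : IsCochar φ v) (n : ℕ) : IsCochar (φ ^ n) ((n : ℂ) • v) := by
  induction n with
  | zero => simpa using one
  | succ n ih =>
    rw [pow_succ]
    push_cast
    rw [add_smul, one_smul]
    exact ih.mul h ((Commute.refl v).smul_left _)

/-- Reading the coefficient of `T^n` in the second tensor factor turns the left side into `φ φ_n`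
and the right side into `T^n φ_n`. Thus a solution of the differential equation is a genuine
homomorphism `𝔾ₘ → G`. -/
theorem map_comul (h : IsCochar φ v) (a : A) :
    TensorProduct.map φ.ofConv.toLinearMap φ.ofConv.toLinearMap (comul (R := ℂ) a) =
      comul (R := ℂ) (φ a) := by
  apply tensor_ext
  intro n
  apply (TensorProduct.rid ℂ ℂ[T;T⁻¹]).injective
  have h1 := congrArg (fun f : Fn A ℂ[T;T⁻¹] => f a) (h.lin_mul_component n)
  have h2 : TensorProduct.rid ℂ ℂ[T;T⁻¹] ((coeffL n).lTensor ℂ[T;T⁻¹]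
      (TensorProduct.map φ.ofConv.toLinearMap φ.ofConv.toLinearMap (comul (R := ℂ) a))) =
      (Pts.lin φ * Fn.cst ℂ[T;T⁻¹] (component φ n)) a := by
    rw [← (ℛ ℂ a).eq, (ℛ ℂ a).convMul_apply]
    simp only [map_sum, TensorProduct.map_tmul, LinearMap.lTensor_tmul, TensorProduct.rid_tmul]
    refine Finset.sum_congr rfl fun i _ => ?_
    rw [Algebra.smul_def, mul_comm]
    rfl
  rw [h2]
  refine h1.trans ?_
  have h3 : (TensorProduct.rid ℂ ℂ[T;T⁻¹]).toLinearMap ∘ₗ (coeffL n).lTensor ℂ[T;T⁻¹] ∘ₗ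
      comul (R := ℂ) (A := ℂ[T;T⁻¹]) = (coeffL n).smulRight (T n) := by
    apply linearMap_ext
    intro m
    simp only [LinearMap.comp_apply, comul_T, LinearMap.lTensor_tmul, LinearEquiv.coe_coe,
      TensorProduct.rid_tmul, LinearMap.smulRight_apply, coeffL_T]
    split_ifs with hm
    · rw [hm]
    · simp
  refine Eq.trans ?_ (congrArg (fun l => l (φ a)) h3).symm
  change (T n : ℂ[T;T⁻¹]) * algebraMap ℂ ℂ[T;T⁻¹] (coeffL n (φ a)) = coeffL n (φ a) • T n
  rw [mul_comm, Algebra.smul_def]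

/-- The homomorphism of bialgebras of a cocharacter. -/
def toBialgHom (h : IsCochar φ v) : A →ₐc[ℂ] ℂ[T;T⁻¹] :=
  BialgHom.ofAlgHom φ.ofConv
    (by
      ext a
      have := congrArg (fun g : Pts A ℂ => g a) h.map_one
      exact (counit_eq _).trans this)
    (by
      ext a
      exact h.map_comul a)

theorem toBialgHom_apply (h : IsCochar φ v) (a : A) : h.toBialgHom a = φ a := rfl

/-- Powers of `T` are grouplike and `(r s)^n = r^n s^n`, so compatibility with comultiplication
gives multiplicativity on units. -/
theorem map_evalUnit_mul (h : IsCochar φ v) (r s : Sˣ) :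
    Pts.map (evalUnit (r * s)) φ = Pts.map (evalUnit r) φ * Pts.map (evalUnit s) φ := by
  apply Pts.lin_injective
  ext1
  refine LinearMap.ext fun a => ?_
  have h1 : (evalUnit (r * s)).toLinearMap =
      LinearMap.mul' ℂ S ∘ₗ TensorProduct.map (evalUnit r).toLinearMap (evalUnit s).toLinearMap ∘ₗ
        comul (R := ℂ) (A := ℂ[T;T⁻¹]) := by
    apply linearMap_ext
    intro n
    simp [evalUnit_T, mul_zpow]
  rw [_root_.map_mul]
  change (evalUnit (r * s)).toLinearMap (φ a) =
    (Pts.lin (Pts.map (evalUnit r) φ) * Pts.lin (Pts.map (evalUnit s) φ)) a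
  rw [h1, LinearMap.comp_apply, LinearMap.comp_apply, ← h.map_comul, ← (ℛ ℂ a).eq,
    (ℛ ℂ a).convMul_apply]
  simp only [map_sum, TensorProduct.map_tmul, LinearMap.mul'_apply]
  rfl

theorem map_evalUnit_one (h : IsCochar φ v) : Pts.map (evalUnit (1 : Sˣ)) φ = 1 := by
  have h1 : evalUnit (1 : Sˣ) = (Algebra.ofId ℂ S).comp evalOne := by
    apply algHom_ext
    intro n
    simp [evalUnit_T]
  rw [h1, ← Pts.map_map, h.map_one, Pts.map_one]

theorem map_evalUnit_inv (h : IsCochar φ v) (r : Sˣ) :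
    Pts.map (evalUnit r⁻¹) φ = (Pts.map (evalUnit r) φ)⁻¹ :=
  eq_inv_of_mul_eq_one_left (by
    rw [← h.map_evalUnit_mul, inv_mul_cancel, h.map_evalUnit_one])

theorem map_evalUnit_pow (h : IsCochar φ v) (n : ℕ) :
    Pts.map (evalUnit (unitT 1 ^ n)) φ = φ ^ n := by
  induction n with
  | zero => rw [pow_zero, pow_zero, h.map_evalUnit_one]
  | succ n ih =>
    rw [pow_succ, h.map_evalUnit_mul, ih, pow_succ, evalUnit_unitT_one]
    rfl

end IsCochar

/-! ### Coweights and the differential equation of a cocharacter -/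

namespace Coweight

variable {H : LieSubalgebra ℂ (LieAlg A)}

/-- `T d/dT` is the invariant vector field on `𝔾ₘ`: it is comultiplication followed by the
derivative at `1` on the first factor. Compatibility of `μ` with comultiplication carries this over
to `G`. -/
theorem isCochar (μ : Coweight H) : IsCochar μ.tPow (LieAlg.fn μ.val.1) where
  theta_eq := by
    ext1
    refine LinearMap.ext fun a => ?_
    have h1 : (Laurent.theta : ℂ[T;T⁻¹] →ₗ[ℂ] ℂ[T;T⁻¹]) =
        TensorProduct.lid ℂ ℂ[T;T⁻¹] ∘ₗ (evalOne.toLinearMap ∘ₗ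
          (Laurent.theta : ℂ[T;T⁻¹] →ₗ[ℂ] ℂ[T;T⁻¹])).rTensor ℂ[T;T⁻¹] ∘ₗ
        comul (R := ℂ) (A := ℂ[T;T⁻¹]) := by
      apply linearMap_ext
      intro n
      simp [theta_T, evalOne_T]
    have h2 : comul (R := ℂ) (μ.cochar a) = TensorProduct.map (μ.cochar : A →ₗ[ℂ] ℂ[T;T⁻¹])
        (μ.cochar : A →ₗ[ℂ] ℂ[T;T⁻¹]) (comul (R := ℂ) a) :=
      (CoalgHomClass.map_comp_comul_apply μ.cochar a).symm
    change (Laurent.theta : ℂ[T;T⁻¹] →ₗ[ℂ] ℂ[T;T⁻¹]) (μ.cochar a) = (_ * _ : Fn A ℂ[T;T⁻¹]) a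
    rw [h1, LinearMap.comp_apply, LinearMap.comp_apply, h2, ← (ℛ ℂ a).eq, (ℛ ℂ a).convMul_apply]
    simp only [map_sum, TensorProduct.map_tmul, LinearMap.rTensor_tmul]
    refine Finset.sum_congr rfl fun i _ => ?_
    rw [Fn.cst_apply, LieAlg.fn_apply, μ.counit_val, derivOne_eq, ← Algebra.smul_def]
    rfl
  map_one := by
    apply Pts.lin_injective
    ext1
    refine LinearMap.ext fun a => ?_
    change evalOne (μ.cochar a) = counit (R := ℂ) a
    rw [← counit_eq]
    exact CoalgHomClass.counit_comp_apply μ.cochar a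

/-- The coweight of a cocharacter with derivative in `H`. -/
def ofIsCochar {φ : Pts A ℂ[T;T⁻¹]} (v : H) (h : IsCochar φ (LieAlg.fn v.1)) : Coweight H where
  cochar := h.toBialgHom
  val := v
  counit_val a := by
    rw [derivOne_eq, h.toBialgHom_apply]
    exact (congrArg (fun f : Fn A ℂ => f a) h.evalOne_theta).symm

theorem tPow_ofIsCochar {φ : Pts A ℂ[T;T⁻¹]} (v : H) (h : IsCochar φ (LieAlg.fn v.1)) :
    (ofIsCochar v h).tPow = φ := rfl

end Coweight

end HeckeP1
end

noncomputable section

namespace HeckeP1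

variable {A : Type u} [CommRing A] [HopfAlgebra ℂ A]
variable {R S : Type*} [CommRing R] [Algebra ℂ R] [CommRing S] [Algebra ℂ S]

open Laurent
open LaurentPolynomial (T)

/-! ### Exponentials with values in an arbitrary ring -/

/-- The element `exp(r x)` of `G(R)`. -/
def expAt (x : LieAlg A) (hx : LocNilp x) (r : R) : Pts A R :=
  Pts.map (Polynomial.aeval r) (expCurve x hx)

theorem expT_eq_expAt (x : LieAlg A) (hx : LocNilp x) (j : ℕ) :
    expT x hx j = expAt x hx (T (j : ℤ)) := rfl

section expAt

variable (x : LieAlg A) (hx : LocNilp x)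

theorem map_expAt (φ : R →ₐ[ℂ] S) (r : R) : Pts.map φ (expAt x hx r) = expAt x hx (φ r) := by
  rw [expAt, expAt, Pts.map_map]
  congr 1
  apply Polynomial.algHom_ext
  simp

theorem map_smul_cst (r : R) (p : ℂ[X]) (u : Fn A ℂ) :
    Fn.map (Polynomial.aeval r) (p • Fn.cst ℂ[X] u) = Polynomial.aeval r p • Fn.cst R u := by
  rw [Fn.map_smul, Fn.map_cst]

theorem deriv_expAt (D : Derivation ℂ R R) (r : R) :
    Fn.comp (D : R →ₗ[ℂ] R) (Pts.lin (expAt x hx r)) =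
      D r • (Fn.cst R (LieAlg.fn x) * Pts.lin (expAt x hx r)) := by
  have h := congrArg (Fn.map (Polynomial.aeval r)) (polyDeriv_expCurve x hx)
  rw [_root_.map_mul, Fn.map_cst, ← Pts.lin_map] at h
  rw [expAt, ← h]
  ext1
  refine LinearMap.ext fun a => ?_
  change D (Polynomial.aeval r (expCurve x hx a)) =
    D r * Polynomial.aeval r (Polynomial.derivative (expCurve x hx a))
  rw [Derivation.map_aeval, smul_eq_mul, mul_comm]

theorem commute_expAt (r : R) :
    Commute (Fn.cst R (LieAlg.fn x)) (Pts.lin (expAt x hx r)) := by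
  have h := congrArg (Fn.map (Polynomial.aeval r)) (expCurve_commute x hx).eq
  rwa [_root_.map_mul, _root_.map_mul, Fn.map_cst, ← Pts.lin_map] at h

variable {x} {h y : LieAlg A}

theorem cst_h_mul_expAt (ht : IsSl2Triple h x y) (r : R) :
    Fn.cst R (LieAlg.fn h) * Pts.lin (expAt x hx r) = Pts.lin (expAt x hx r) *
      (Fn.cst R (LieAlg.fn h) + ((2 : R) * r) • Fn.cst R (LieAlg.fn x)) := by
  have h1 := congrArg (Fn.map (Polynomial.aeval r)) (cst_mul_expCurve x hx (LieAlg.fn h))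
  rw [adExp_h hx ht, _root_.map_mul, _root_.map_mul, map_add, map_smul_cst, Fn.map_cst,
    ← Pts.lin_map, map_smul, Polynomial.aeval_X, ofNat_smul_eq_nsmul, nsmul_eq_mul] at h1
  exact h1

theorem cst_f_mul_expAt (ht : IsSl2Triple h x y) (r : R) :
    Fn.cst R (LieAlg.fn y) * Pts.lin (expAt x hx r) = Pts.lin (expAt x hx r) *
      (Fn.cst R (LieAlg.fn y) - r • Fn.cst R (LieAlg.fn h) -
        r ^ 2 • Fn.cst R (LieAlg.fn x)) := by
  have h1 := congrArg (Fn.map (Polynomial.aeval r)) (cst_mul_expCurve x hx (LieAlg.fn y))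
  rw [adExp_f hx ht, _root_.map_mul, _root_.map_mul, map_sub, map_sub, map_smul_cst, map_smul_cst,
    Fn.map_cst, ← Pts.lin_map, _root_.map_pow, Polynomial.aeval_X] at h1
  exact h1

variable (x)

/-- A partial sum of the exponential series. -/
def expTrunc (r : R) (N : ℕ) : Fn A R :=
  ∑ n ∈ Finset.range N, r ^ n • Fn.cst R ((n.factorial : ℂ)⁻¹ • LieAlg.fn x ^ n)

theorem expTrunc_apply (r : R) {N : ℕ} {a : A} (hN : (expCurve x hx a).natDegree < N) :
    expTrunc x r N a = expAt x hx r a := by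
  change expTrunc x r N a = Polynomial.aeval r (expCurve x hx a)
  rw [Polynomial.aeval_eq_sum_range' hN, expTrunc, WithConv.ofConv_sum, LinearMap.sum_apply]
  refine Finset.sum_congr rfl fun n _ => ?_
  have h1 := congrArg (fun f : Fn A ℂ => f a) (comp_lcoeff_expCurve x hx n)
  change r ^ n * algebraMap ℂ R (((n.factorial : ℂ)⁻¹ • LieAlg.fn x ^ n : Fn A ℂ) a) = _
  rw [Algebra.smul_def _ (r ^ n), mul_comm]
  exact congrArg (fun c => algebraMap ℂ R c * r ^ n) h1.symm

/-- The exponential series is finite only after evaluation at an element of `A`. Its product with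
`f` at `a` involves the finitely many tensor components of the comultiplication of `a`, so one bound
on their degrees serves for all `r` and `f`. -/
theorem exists_expTrunc (a : A) : ∃ N₀ : ℕ, ∀ N, N₀ ≤ N → ∀ (r : R) (f : Fn A R),
    (f * expTrunc x r N) a = (f * Pts.lin (expAt x hx r)) a ∧
    (expTrunc x r N * f) a = (Pts.lin (expAt x hx r) * f) a := by
  refine ⟨(ℛ ℂ a).index.sup (fun i => (expCurve x hx ((ℛ ℂ a).left i)).natDegree +
    (expCurve x hx ((ℛ ℂ a).right i)).natDegree) + 1, fun N hN r f => ⟨?_, ?_⟩⟩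
  all_goals
    rw [(ℛ ℂ a).convMul_apply, (ℛ ℂ a).convMul_apply]
    refine Finset.sum_congr rfl fun i hi => ?_
    have h1 := Finset.le_sup (f := fun i => (expCurve x hx ((ℛ ℂ a).left i)).natDegree +
      (expCurve x hx ((ℛ ℂ a).right i)).natDegree) hi
    rw [expTrunc_apply x hx r (by omega)]
    rfl

/-- Conjugation of an exponential by a cocharacter. -/
theorem IsCochar.mul_expAt {φ : Pts A ℂ[T;T⁻¹]} {v : Fn A ℂ} (h : IsCochar φ v) {k : ℤ}
    (hk : v * LieAlg.fn x - LieAlg.fn x * v = (k : ℂ) • LieAlg.fn x) (r : ℂ[T;T⁻¹]) :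
    φ * expAt x hx r = expAt x hx (T k * r) * φ := by
  have h1 := h.lin_mul_cst hk
  have h2 : ∀ n : ℕ, Pts.lin φ * Fn.cst ℂ[T;T⁻¹] (LieAlg.fn x) ^ n =
      (T k : ℂ[T;T⁻¹]) ^ n • (Fn.cst ℂ[T;T⁻¹] (LieAlg.fn x) ^ n * Pts.lin φ) := by
    intro n
    induction n with
    | zero => simp
    | succ n ih =>
      rw [pow_succ, ← mul_assoc, ih, smul_mul_assoc, mul_assoc, h1, mul_smul_comm, smul_smul,
        ← mul_assoc, ← pow_succ, ← pow_succ]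
  have h3 : ∀ N, Pts.lin φ * expTrunc x r N = expTrunc x (T k * r) N * Pts.lin φ := by
    intro N
    rw [expTrunc, expTrunc, Finset.mul_sum, Finset.sum_mul]
    refine Finset.sum_congr rfl fun n _ => ?_
    rw [map_smul, _root_.map_pow, mul_smul_comm, mul_smul_comm, h2, smul_mul_assoc, smul_mul_assoc,
      smul_comm (_ : ℂ) (T k ^ n : ℂ[T;T⁻¹]), smul_smul, mul_pow, mul_comm (r ^ n)]
  apply Pts.lin_injective
  ext1
  refine LinearMap.ext fun a => ?_
  rw [_root_.map_mul, _root_.map_mul]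
  -- The bound depends only on `a`, so a single `N` works for both parameters `r` and `T^k r`.
  obtain ⟨N, hN⟩ := exists_expTrunc x hx (R := ℂ[T;T⁻¹]) a
  refine ((hN N le_rfl r (Pts.lin φ)).1.symm.trans ?_).trans
    (hN N le_rfl (T k * r) (Pts.lin φ)).2
  rw [h3]

end expAt

/-! ### The coroot of an `𝔰𝔩₂`-triple as a cocharacter -/

/-- Here `x` and `y` stand for `exp(a X)` and `exp(b Y)`. All Lie algebra elements are moved to the
right of `y x y` by the adjoint formulas; when `a b = -1`, the coefficients of `X` and `Y` cancel.
-/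
theorem weyl_deriv_identity {K B : Type*} [CommRing K] [Ring B] [Algebra K B] {a b : K} (hab : a * b = -1)
    {x y X Y H : B} (hY : Y * x = x * (Y - a • H - a ^ 2 • X))
    (hH : H * y = y * (H - (2 * b) • Y)) (hX : X * y = y * (X + b • H - b ^ 2 • Y))
    (hYy : Y * y = y * Y) (hXx : X * x = x * X) :
    ((-b) • (Y * y) * x + y * (a • (X * x))) * y + y * x * ((-b) • (Y * y)) =
      -(y * x * y * H) := by
  have e1 : Y * y * x * y = y * x * y * (Y - a • (H - (2 * b) • Y) -
      a ^ 2 • (X + b • H - b ^ 2 • Y)) := by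
    rw [hYy, mul_assoc y Y x, hY]
    have : y * (x * (Y - a • H - a ^ 2 • X)) * y =
        y * x * (Y * y - a • (H * y) - a ^ 2 • (X * y)) := by
      simp only [mul_sub, sub_mul, mul_smul_comm, smul_mul_assoc, mul_assoc]
    rw [this, hYy, hH, hX]
    simp only [mul_sub, mul_add, mul_smul_comm, mul_assoc]
  have e2 : y * (X * x) * y = y * x * y * (X + b • H - b ^ 2 • Y) := by
    rw [hXx, ← mul_assoc, mul_assoc _ X y, hX, ← mul_assoc]
  have e3 : y * x * (Y * y) = y * x * y * Y := by
    rw [hYy, ← mul_assoc]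
  rw [add_mul, smul_mul_assoc, smul_mul_assoc, e1, mul_smul_comm, smul_mul_assoc, e2,
    mul_smul_comm, e3]
  generalize y * x * y = W
  simp only [mul_sub, mul_add, mul_smul_comm]
  rw [← sub_eq_zero]
  -- The difference of the two sides is divisible by `a b + 1`; this is its factored form.
  trans (a * b + 1) • (a • (W * X) + (a * b + 1) • (W * H) - (b * (a * b + 2)) • (W * Y))
  · module
  · rw [hab, neg_add_cancel, zero_smul]

section triple

variable {x y h : LieAlg A} (hx : LocNilp x) (hy : LocNilp y)

/-- The curve `exp(-T⁻¹ y) exp(T x) exp(-T⁻¹ y)`. -/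
def weylCurve : Pts A ℂ[T;T⁻¹] :=
  expAt y hy (-T (-1)) * expAt x hx (T 1) * expAt y hy (-T (-1))

theorem theta_weylCurve (ht : IsSl2Triple h x y) :
    Fn.theta (Pts.lin (weylCurve hx hy)) =
      -(Pts.lin (weylCurve hx hy) * Fn.cst ℂ[T;T⁻¹] (LieAlg.fn h)) := by
  have hT : Laurent.theta (-T (-1) : ℂ[T;T⁻¹]) = T (-1) := by
    rw [map_neg, theta_T]; simp
  have hT' : Laurent.theta (T 1 : ℂ[T;T⁻¹]) = T 1 := by
    rw [theta_T]; simp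
  -- The formulas for conjugation by `exp(-T⁻¹ y)` come from the opposite triple `(-h, y, x)`.
  have hH := cst_h_mul_expAt hy ht.symm (-T (-1) : ℂ[T;T⁻¹])
  have hX := cst_f_mul_expAt hy ht.symm (-T (-1) : ℂ[T;T⁻¹])
  rw [map_neg, map_neg] at hH hX
  have key := weyl_deriv_identity (K := ℂ[T;T⁻¹]) (a := T 1) (b := -T (-1))
    (by rw [mul_neg, ← LaurentPolynomial.T_add]; simp)
    (cst_f_mul_expAt hx ht (T 1 : ℂ[T;T⁻¹]))
    (by have := congrArg Neg.neg hH
        rw [neg_mul, neg_neg] at this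
        rw [this, ← mul_neg]
        congr 1
        module)
    (by rw [hX]
        congr 1
        module)
    (commute_expAt y hy (-T (-1) : ℂ[T;T⁻¹])).eq (commute_expAt x hx (T 1 : ℂ[T;T⁻¹])).eq
  rw [neg_neg] at key
  rw [weylCurve, Fn.theta, _root_.map_mul Pts.lin, _root_.map_mul Pts.lin, Fn.comp_deriv_mul, Fn.comp_deriv_mul,
    deriv_expAt, deriv_expAt, hT, hT', key]

/-- The value at `T = 1` of `weylCurve`, a representative of the reflection in the Weyl group. -/
def weylElt : Pts A ℂ := Pts.map evalOne (weylCurve hx hy)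

/-- The coroot as a point of `G(ℂ[T, T⁻¹])`. -/
def corootCurve : Pts A ℂ[T;T⁻¹] :=
  (weylCurve hx hy)⁻¹ * Pts.map (Algebra.ofId ℂ ℂ[T;T⁻¹]) (weylElt hx hy)

theorem lin_map_ofId (g : Pts A ℂ) :
    Pts.lin (Pts.map (Algebra.ofId ℂ R) g) = Fn.cst R (Pts.lin g) := rfl

theorem Pts.map_ofId (φ : R →ₐ[ℂ] S) (g : Pts A ℂ) :
    Pts.map φ (Pts.map (Algebra.ofId ℂ R) g) = Pts.map (Algebra.ofId ℂ S) g := by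
  rw [Pts.map_map]
  congr 1
  exact Subsingleton.elim _ _

/-- Inverting `θ W = -W h` gives `θ W⁻¹ = h W⁻¹`; the constant factor `W(1)` on the right preserves
this equation and normalizes the value at `T = 1`. -/
theorem isCochar_corootCurve (ht : IsSl2Triple h x y) :
    IsCochar (corootCurve hx hy) (LieAlg.fn h) where
  theta_eq := by
    have h1 := theta_weylCurve hx hy ht
    have h2 := Pts.comp_deriv_inv Laurent.theta (weylCurve hx hy)
    rw [Fn.theta] at h1 ⊢
    rw [h1, mul_neg, neg_mul, neg_neg, ← mul_assoc, Pts.lin_inv_mul_lin, one_mul] at h2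
    rw [corootCurve, _root_.map_mul, Fn.comp_deriv_mul, h2, lin_map_ofId, Fn.comp_deriv_cst,
      mul_zero, add_zero, mul_assoc]
  map_one := by
    rw [corootCurve, Pts.map_mul, Pts.map_inv, Pts.map_ofId]
    exact inv_mul_cancel _

/-- For exponent `1` this is the definition of the coroot curve solved for `exp(T x)`. The general
case is the substitution `T ↦ T^m`, which raises a cocharacter to its `m`-th power. -/
theorem expAt_T_eq (ht : IsSl2Triple h x y) (m : ℕ) :
    expAt x hx (T (m : ℤ) : ℂ[T;T⁻¹]) = (expAt y hy (-T (-(m : ℤ))))⁻¹ *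
      Pts.map (Algebra.ofId ℂ ℂ[T;T⁻¹]) (weylElt hx hy) * (corootCurve hx hy ^ m)⁻¹ *
      (expAt y hy (-T (-(m : ℤ))))⁻¹ := by
  have hpow : ∀ m : ℕ, ((unitT 1 ^ m : (ℂ[T;T⁻¹])ˣ) : ℂ[T;T⁻¹]) = T (m : ℤ) := by
    intro m
    rw [Units.val_pow_eq_pow_val]
    change (T 1 : ℂ[T;T⁻¹]) ^ m = _
    rw [LaurentPolynomial.T_pow, mul_one]
  have hinv : (((unitT 1 ^ m)⁻¹ : (ℂ[T;T⁻¹])ˣ) : ℂ[T;T⁻¹]) = T (-(m : ℤ)) := by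
    rw [Units.inv_eq_of_mul_eq_one_right]
    rw [hpow, ← LaurentPolynomial.T_add]
    simp
  have h1 : expAt x hx (T 1 : ℂ[T;T⁻¹]) = (expAt y hy (-T (-1)))⁻¹ *
      Pts.map (Algebra.ofId ℂ ℂ[T;T⁻¹]) (weylElt hx hy) * (corootCurve hx hy)⁻¹ *
      (expAt y hy (-T (-1)))⁻¹ := by
    rw [corootCurve, weylCurve]
    group
  have h2 := congrArg (Pts.map (evalUnit (unitT 1 ^ m))) h1
  have h3 := (isCochar_corootCurve hx hy ht).map_evalUnit_pow m
  rw [map_expAt, evalUnit_T, zpow_one, hpow] at h2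
  simp only [Pts.map_mul, Pts.map_inv, map_expAt, Pts.map_ofId, h3, map_neg, evalUnit_T,
    zpow_neg, zpow_one, hinv] at h2
  exact h2

end triple

/-! ### Hecke modifications in terms of the loop group -/

section core

variable {H : LieSubalgebra ℂ (LieAlg A)} [IsLieAbelian H]

theorem fn_commute (v w : H) : Commute (LieAlg.fn v.1) (LieAlg.fn w.1) := by
  have h0 : ⁅v, w⁆ = 0 := trivial_lie_zero H H v w
  have h1 : ⁅v.1, w.1⁆ = 0 := by rw [← LieSubalgebra.coe_bracket, h0]; rfl
  have h2 := LieAlg.fn_lie v.1 w.1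
  rw [h1, map_zero] at h2
  exact (sub_eq_zero.1 h2.symm)

/-- A Birkhoff factorization of the loop `t^μ exp(x t^j) t^λ`. Moving `t^μ` to the right gives
`exp(t^{j+m} x) t^{μ+λ}`; the `SL₂` identity rewrites the exponential through `y`, and the
right-hand `y`-exponential, once moved past `t^{μ+λ}`, becomes polynomial in `t`. -/
theorem exists_coweight_factorization (lam mu : Coweight H) {h : H} {x y : LieAlg A}
    (hx : LocNilp x) (hy : LocNilp y) (ht : IsSl2Triple h.1 x y) {l m j : ℕ} (hj : j < l)
    (hl : ⁅lam.val.1, y⁆ = -((l : ℂ) • y))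
    (hm : ⁅mu.val.1, x⁆ = (m : ℂ) • x) (hm' : ⁅mu.val.1, y⁆ = -((m : ℂ) • y)) :
    ∃ (nu : Coweight H) (k q : Pts A ℂ[X]),
      nu.val = mu.val + lam.val - ((j : ℂ) + m) • h ∧
      mu.tPow * (expT x hx j * lam.tPow) =
        Pts.map (Polynomial.aeval (T (-1) : ℂ[T;T⁻¹])) q * nu.tPow *
          Pts.map (Polynomial.aeval (T 1 : ℂ[T;T⁻¹])) k := by
  have hfn : ∀ {v z : LieAlg A} {c : ℂ}, ⁅v, z⁆ = c • z →
      LieAlg.fn v * LieAlg.fn z - LieAlg.fn z * LieAlg.fn v = c • LieAlg.fn z := by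
    intro v z c hv
    rw [← LieAlg.fn_lie, hv, map_smul]
  have hcomm : Commute (-(((j + m : ℕ) : ℂ) • LieAlg.fn h.1))
      (LieAlg.fn mu.val.1 + LieAlg.fn lam.val.1) :=
    (((fn_commute h mu.val).add_right (fn_commute h lam.val)).smul_left _).neg_left
  have hcoch := ((isCochar_corootCurve hx hy ht).pow (j + m)).inv.mul
    (mu.isCochar.mul lam.isCochar (fn_commute _ _)) hcomm
  have hval : -(((j + m : ℕ) : ℂ) • LieAlg.fn h.1) + (LieAlg.fn mu.val.1 + LieAlg.fn lam.val.1) =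
      LieAlg.fn (mu.val + lam.val - ((j : ℂ) + m) • h : H).1 := by
    change _ = LieAlg.fn (mu.val.1 + lam.val.1 - ((j : ℂ) + m) • h.1)
    rw [map_sub, map_add, map_smul]
    push_cast
    abel
  rw [hval] at hcoch
  -- So `k = exp(s^{l-j} y)` and `q = exp(s^{j+m} y) w`, to be evaluated at `t` and `t⁻¹`. The
  -- difference `l - j` is not truncated because `j < l`.
  refine ⟨Coweight.ofIsCochar _ hcoch, (expAt y hy (-Polynomial.X ^ (l - j)))⁻¹,
    (expAt y hy (-Polynomial.X ^ (j + m)))⁻¹ *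
      Pts.map (Algebra.ofId ℂ ℂ[X]) (weylElt hx hy), rfl, ?_⟩
  have e1 := mu.isCochar.mul_expAt x hx (k := m) (by exact_mod_cast hfn hm) (T (j : ℤ))
  have e2 := lam.isCochar.mul_expAt y hy (k := -l)
    (by rw [hfn (c := -(l : ℂ)) (by rw [hl, neg_smul])]; push_cast; rfl) (-T ((l - j : ℕ) : ℤ))
  have e3 := mu.isCochar.mul_expAt y hy (k := -m)
    (by rw [hfn (c := -(m : ℂ)) (by rw [hm', neg_smul])]; push_cast; rfl) (-T (-(j : ℤ)))
  have hT1 : (T (-(l : ℤ)) * -T ((l - j : ℕ) : ℤ) : ℂ[T;T⁻¹]) = -T (-(j : ℤ)) := by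
    rw [mul_neg, ← LaurentPolynomial.T_add]
    congr 2
    omega
  have hT2 : (T (-(m : ℤ)) * -T (-(j : ℤ)) : ℂ[T;T⁻¹]) = -T (-((j + m : ℕ) : ℤ)) := by
    rw [mul_neg, ← LaurentPolynomial.T_add]
    congr 2
    omega
  have hT3 : (T (m : ℤ) * T (j : ℤ) : ℂ[T;T⁻¹]) = T ((j + m : ℕ) : ℤ) := by
    rw [← LaurentPolynomial.T_add]
    congr 1
    omega
  rw [hT1] at e2
  rw [hT2] at e3
  rw [hT3, expAt_T_eq hx hy ht (j + m)] at e1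
  have hk : Pts.map (Polynomial.aeval (T 1 : ℂ[T;T⁻¹]))
      (expAt y hy (-Polynomial.X ^ (l - j) : ℂ[X]))⁻¹ =
      (expAt y hy (-T ((l - j : ℕ) : ℤ)))⁻¹ := by
    rw [Pts.map_inv, map_expAt, map_neg, _root_.map_pow, Polynomial.aeval_X,
      LaurentPolynomial.T_pow, mul_one]
  have hq : Pts.map (Polynomial.aeval (T (-1) : ℂ[T;T⁻¹]))
      (expAt y hy (-Polynomial.X ^ (j + m) : ℂ[X]))⁻¹ =
      (expAt y hy (-T (-((j + m : ℕ) : ℤ))))⁻¹ := by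
    rw [Pts.map_inv, map_expAt, map_neg, _root_.map_pow, Polynomial.aeval_X,
      LaurentPolynomial.T_pow]
    congr 4
    ring
  rw [hk, Pts.map_mul, hq, Pts.map_ofId, Coweight.tPow_ofIsCochar]
  -- Passing `t^λ` lowers the exponent of `t` from `l - j` to `-j`, and passing `t^μ` lowers it
  -- further to `-(j + m)`.
  have e4 : mu.tPow * lam.tPow * (expAt y hy (-T ((l - j : ℕ) : ℤ)))⁻¹ =
      (expAt y hy (-T (-((j + m : ℕ) : ℤ))))⁻¹ * (mu.tPow * lam.tPow) := by
    rw [mul_inv_eq_iff_eq_mul, mul_assoc _ (mu.tPow * lam.tPow), eq_inv_mul_iff_mul_eq,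
      mul_assoc mu.tPow, e2, ← mul_assoc, ← mul_assoc, e3]
  rw [← mul_assoc]
  rw [expT_eq_expAt, e1]
  simp only [mul_assoc] at e4 ⊢
  rw [e4]

end core

end HeckeP1
end

noncomputable section

namespace HeckeP1

variable {A : Type u} [CommRing A] [HopfAlgebra ℂ A]

open Laurent
open LaurentPolynomial (T)

/-! ### Isomorphisms of bundles -/

namespace GBundle.Iso

variable {P Q Q' : GBundle A}

/-- The inverse of an isomorphism. -/
def symm (e : Iso P Q) : Iso Q P where
  equiv U := (e.equiv U).symm
  equiv_res h s := by rw [Equiv.symm_apply_eq, e.equiv_res, Equiv.apply_symm_apply]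
  equiv_act s g := by rw [Equiv.symm_apply_eq, e.equiv_act, Equiv.apply_symm_apply]

/-- The composition of two isomorphisms. -/
def trans (e : Iso P Q) (f : Iso Q Q') : Iso P Q' where
  equiv U := (e.equiv U).trans (f.equiv U)
  equiv_res h s := by
    rw [Equiv.trans_apply, Equiv.trans_apply, e.equiv_res, f.equiv_res]
  equiv_act s g := by
    rw [Equiv.trans_apply, Equiv.trans_apply, e.equiv_act, f.equiv_act]

end GBundle.Iso

/-! ### Membership in local rings -/

theorem map_aeval_mem (S : Subalgebra ℂ (RatFunc ℂ)) {r : RatFunc ℂ} (hr : r ∈ S)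
    (k : Pts A ℂ[X]) : Pts.map (Polynomial.aeval r) k ∈ subPts A S := fun a => by
  change Polynomial.aeval ((⟨r, hr⟩ : S) : RatFunc ℂ) (k a) ∈ S
  rw [Subalgebra.aeval_coe]
  exact Subtype.coe_prop _

/-- As `r` is a unit of `S`, the substitution `T ↦ r` factors through `S`. -/
theorem map_evalUnit_mem (S : Subalgebra ℂ (RatFunc ℂ)) {r : (RatFunc ℂ)ˣ}
    (hr : (r : RatFunc ℂ) ∈ S) (hr' : ((r⁻¹ : (RatFunc ℂ)ˣ) : RatFunc ℂ) ∈ S)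
    (g : Pts A ℂ[T;T⁻¹]) : Pts.map (evalUnit r) g ∈ subPts A S := fun a => by
  have h : evalUnit r = S.val.comp (evalUnit (S := S) ⟨⟨r, hr⟩, ⟨_, hr'⟩,
      Subtype.ext r.mul_inv, Subtype.ext r.inv_mul⟩) := by
    apply algHom_ext
    intro n
    rw [AlgHom.comp_apply, evalUnit_T, evalUnit_T]
    cases n with
    | ofNat n => simp
    | negSucc n => simp [zpow_negSucc, ← inv_pow]
  change evalUnit r (g a) ∈ S
  rw [h]
  exact Subtype.coe_prop _

theorem map_shift_mem_localRing {z w : ℂ} (hw : w ≠ z) (g : Pts A ℂ[T;T⁻¹]) :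
    Pts.map (shift z) g ∈ subPts A (localRing (w : OnePoint ℂ)) :=
  fun a => shift_mem_localRing z w hw (g a)

theorem shift_eq_evalUnit (z : ℂ) : shift z = evalUnit (shiftUnit z) := rfl

theorem shiftUnit_div_mem (z w : ℂ) :
    ((shiftUnit z * (shiftUnit w)⁻¹ : (RatFunc ℂ)ˣ) : RatFunc ℂ) ∈ localRingInfty :=
  ⟨Polynomial.X - Polynomial.C z, Polynomial.X - Polynomial.C w, Polynomial.X_sub_C_ne_zero w,
    by rw [Polynomial.natDegree_X_sub_C, Polynomial.natDegree_X_sub_C], by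
      rw [div_eq_mul_inv]; rfl⟩

/-- By multiplicativity the quotient is `φ` evaluated at `(t - z) / (t - w)`, a unit of the local
ring at `∞`. -/
theorem IsCochar.shift_div_mem {φ : Pts A ℂ[T;T⁻¹]} {v : Fn A ℂ} (h : IsCochar φ v) (z w : ℂ) :
    Pts.map (shift z) φ * (Pts.map (shift w) φ)⁻¹ ∈ subPts A localRingInfty := by
  rw [shift_eq_evalUnit, shift_eq_evalUnit, ← h.map_evalUnit_inv, ← h.map_evalUnit_mul]
  refine map_evalUnit_mem _ (shiftUnit_div_mem z w) ?_ φ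
  rw [mul_inv_rev, inv_inv]
  exact shiftUnit_div_mem w z

/-! ### Comparing a Hecke modification with the bundle of a coweight -/

section compare

variable {H : LieSubalgebra ℂ (LieAlg A)}

/-- In the trivialization over `𝔸¹` the section `γ` is `1`, so the modification condition concerns
the right component alone. -/
theorem isModifiedSec_iff {μ : Coweight H} {p : TangentPt} {h : Pts A ℂ[T;T⁻¹]} {U : ZOpen}
    {hh : Pts.map (shift p.1) h ∈ points A (ZOpen.affine.erase (p.1 : OnePoint ℂ))}
    (s : (bundle μ).sec (U.erase (p.1 : OnePoint ℂ))) :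
    (bundle μ).IsModifiedSec (p.1 : OnePoint ℂ)
      (GBundle.glueSection ZOpen.affineInfty ZOpen.affine ZOpen.cover_affine _)
      ⟨Pts.map (shift p.1) h, hh⟩ U s ↔
    ((p.1 : OnePoint ℂ) ∈ U → ∃ b ∈ points A (U.inter ZOpen.affine),
      GBundle.GlueSec.right s = Pts.map (shift p.1) h * b) := by
  refine forall_congr' fun _ => ⟨?_, ?_⟩
  · rintro ⟨b, hb⟩
    refine ⟨b, b.2, ?_⟩
    have := congrArg GBundle.GlueSec.right hb
    refine this.trans ?_
    exact one_mul _
  · rintro ⟨b, hb, e⟩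
    refine ⟨⟨b, hb⟩, GBundle.GlueSec.ext' ?_⟩
    exact e.trans (one_mul _).symm

variable (mu nu : Coweight H) (p : TangentPt) (h : Pts A ℂ[T;T⁻¹]) (g : Pts A (RatFunc ℂ))
  (hg : ∀ w : ℂ, w ≠ p.1 → g ∈ subPts A (localRing (w : OnePoint ℂ)))
  (hz : g * Pts.map (shift p.1) h ∈ subPts A (localRing (p.1 : OnePoint ℂ)))
  (hinf : Pts.map (shift 0) nu.tPow * g * (Pts.map (shift 0) mu.tPow)⁻¹ ∈
    subPts A localRingInfty)

theorem coe_mem_erase {U : ZOpen} {w z : ℂ} (hw : w ≠ z) (hU : (w : OnePoint ℂ) ∈ U) :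
    (w : OnePoint ℂ) ∈ U.erase (z : OnePoint ℂ) :=
  ⟨hU, fun e => hw (OnePoint.coe_injective e)⟩

/-- Left multiplication by `g` as an isomorphism from a Hecke modification to the bundle of a
coweight. -/
def heckeIso : GBundle.Iso (heckeBundle mu p h) (bundle nu) := by
  have fwd : ∀ (U : ZOpen) (s : (heckeBundle mu p h).sec U),
      g * s.1.right ∈ points A (U.inter ZOpen.affine) := by
    intro U s
    refine mem_points.2 fun x hx => ?_
    obtain ⟨w, rfl⟩ := OnePoint.ne_infty_iff_exists.1 hx.2.2
    by_cases hw : w = p.1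
    · subst hw
      obtain ⟨b, hb, e⟩ := (isModifiedSec_iff s.1).1 s.2 hx.1
      -- Near `z` the section is `h(t - z) b` with `b` regular, and `g` cancels the singularity of
      -- `h(t - z)`.
      rw [e, ← mul_assoc]
      exact mul_mem hz (mem_points.1 hb _ hx)
    · exact mul_mem (hg w hw) (mem_points.1 s.1.right_mem _ ⟨coe_mem_erase hw hx.1, hx.2⟩)
  have fwd' : ∀ (U : ZOpen) (s : (heckeBundle mu p h).sec U),
      Pts.map (shift 0) nu.tPow * (g * s.1.right) ∈ points A (U.inter ZOpen.affineInfty) := by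
    intro U s
    refine mem_points.2 fun x hx => ?_
    by_cases hxi : x = OnePoint.infty
    · subst hxi
      -- At `∞` only the component over `𝔸¹_∞` is regular; in these trivializations the map is
      -- multiplication by `t^ν g t^{-μ}`.
      have e : Pts.map (shift 0) nu.tPow * (g * s.1.right) =
          Pts.map (shift 0) nu.tPow * g * (Pts.map (shift 0) mu.tPow)⁻¹ * s.1.left := by
        rw [s.1.eq]; group
      rw [e]
      exact mul_mem hinf (mem_points.1 s.1.left_mem _
        ⟨⟨hx.1, (OnePoint.coe_ne_infty _).symm⟩, hx.2⟩)
    · obtain ⟨w, rfl⟩ := OnePoint.ne_infty_iff_exists.1 hxi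
      refine mul_mem (map_shift_mem_localRing (fun e => hx.2.2 (by rw [e]; rfl)) _)
        (mem_points.1 (fwd U s) _ ⟨hx.1, ZOpen.coe_mem_affine w⟩)
  have bwd : ∀ (U : ZOpen) (s : (bundle nu).sec U),
      g⁻¹ * s.right ∈ points A ((U.erase (p.1 : OnePoint ℂ)).inter ZOpen.affine) := by
    intro U s
    refine mem_points.2 fun x hx => ?_
    obtain ⟨w, rfl⟩ := OnePoint.ne_infty_iff_exists.1 hx.2.2
    have hw : w ≠ p.1 := fun e => hx.1.2 (by rw [e]; rfl)
    exact mul_mem (inv_mem (hg w hw)) (mem_points.1 s.right_mem _ ⟨hx.1.1, hx.2⟩)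
  have bwd' : ∀ (U : ZOpen) (s : (bundle nu).sec U), Pts.map (shift 0) mu.tPow * (g⁻¹ * s.right) ∈
      points A ((U.erase (p.1 : OnePoint ℂ)).inter ZOpen.affineInfty) := by
    intro U s
    refine mem_points.2 fun x hx => ?_
    by_cases hxi : x = OnePoint.infty
    · subst hxi
      have e : Pts.map (shift 0) mu.tPow * (g⁻¹ * s.right) =
          (Pts.map (shift 0) nu.tPow * g * (Pts.map (shift 0) mu.tPow)⁻¹)⁻¹ * s.left := by
        rw [s.eq]; group
      rw [e]
      exact mul_mem (inv_mem hinf) (mem_points.1 s.left_mem _ ⟨hx.1.1, hx.2⟩)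
    · obtain ⟨w, rfl⟩ := OnePoint.ne_infty_iff_exists.1 hxi
      refine mul_mem (map_shift_mem_localRing (fun e => hx.2.2 (by rw [e]; rfl)) _)
        (mem_points.1 (bwd U s) _ ⟨hx.1, ZOpen.coe_mem_affine w⟩)
  have hmod : ∀ (U : ZOpen) (s : (bundle nu).sec U), (p.1 : OnePoint ℂ) ∈ U →
      ∃ b ∈ points A (U.inter ZOpen.affine),
        g⁻¹ * s.right = Pts.map (shift p.1) h * b := by
    intro U s _
    refine ⟨(g * Pts.map (shift p.1) h)⁻¹ * s.right, ?_, by group⟩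
    refine mem_points.2 fun x hx => ?_
    refine mul_mem (inv_mem ?_) (mem_points.1 s.right_mem _ hx)
    obtain ⟨w, rfl⟩ := OnePoint.ne_infty_iff_exists.1 hx.2.2
    by_cases hw : w = p.1
    · rw [hw]; exact hz
    · exact mul_mem (hg w hw) (map_shift_mem_localRing hw h)
  exact
  { equiv := fun U =>
      { toFun := fun s => ⟨_, g * s.1.right, fwd' U s, fwd U s, rfl⟩
        invFun := fun s => ⟨⟨_, g⁻¹ * s.right, bwd' U s, bwd U s, rfl⟩,
          (isModifiedSec_iff _).2 (hmod U s)⟩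
        left_inv := fun s => Subtype.ext (GBundle.GlueSec.ext' (inv_mul_cancel_left _ _))
        right_inv := fun s => GBundle.GlueSec.ext' (mul_inv_cancel_left _ _) }
    equiv_res := fun _ _ => rfl
    equiv_act := fun _ _ => GBundle.GlueSec.ext' (mul_assoc _ _ _).symm }

end compare

/-- If `t^μ h = q(t⁻¹) t^ν k(t)`, then the Hecke modification of the bundle of `μ` by `h` is the
bundle of `ν`. -/
theorem nonempty_iso_of_factorization {H : LieSubalgebra ℂ (LieAlg A)} {mu nu : Coweight H}
    {h : Pts A ℂ[T;T⁻¹]} {k q : Pts A ℂ[X]}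
    (e : mu.tPow * h = Pts.map (Polynomial.aeval (T (-1) : ℂ[T;T⁻¹])) q * nu.tPow *
      Pts.map (Polynomial.aeval (T 1 : ℂ[T;T⁻¹])) k) (p : TangentPt) :
    Nonempty (GBundle.Iso (heckeBundle mu p h) (bundle nu)) := by
  set K := Pts.map (Polynomial.aeval (T 1 : ℂ[T;T⁻¹])) k with hK
  set Q := Pts.map (Polynomial.aeval (T (-1) : ℂ[T;T⁻¹])) q with hQ
  have hmap : ∀ (n : ℤ) (f : Pts A ℂ[X]), Pts.map (shift p.1)
      (Pts.map (Polynomial.aeval (T n : ℂ[T;T⁻¹])) f) =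
      Pts.map (Polynomial.aeval (((shiftUnit p.1) ^ n : (RatFunc ℂ)ˣ) : RatFunc ℂ)) f := by
    intro n f
    rw [Pts.map_map]
    congr 1
    apply Polynomial.algHom_ext
    rw [AlgHom.comp_apply, Polynomial.aeval_X, Polynomial.aeval_X, shift_eq_evalUnit, evalUnit_T]
  -- With `g = (k h⁻¹)(t - z)`, the product `g h(t - z)` is `k(t - z)`, which is regular at `z`.
  refine ⟨heckeIso mu nu p h (Pts.map (shift p.1) (K * h⁻¹))
    (fun w hw => map_shift_mem_localRing hw _) ?_ ?_⟩
  · rw [← Pts.map_mul, inv_mul_cancel_right, hK, hmap]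
    refine map_aeval_mem _ ?_ k
    exact ⟨Polynomial.X - Polynomial.C p.1, 1, by simp, by rw [map_one, div_one, zpow_one]; rfl⟩
  · have e1 : K * h⁻¹ = nu.tPow⁻¹ * Q⁻¹ * mu.tPow := by
      rw [mul_inv_eq_iff_eq_mul, mul_assoc, e]
      group
    -- At `∞` use `k h⁻¹ = t^{-ν} q(t⁻¹)⁻¹ t^μ`. The outer factors are cocharacters at quotients of
    -- `t` and `t - z`, and the middle one is polynomial in `(t - z)⁻¹` up to inversion.
    have e2 : Pts.map (shift 0) nu.tPow * Pts.map (shift p.1) (K * h⁻¹) *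
        (Pts.map (shift 0) mu.tPow)⁻¹ =
        (Pts.map (shift 0) nu.tPow * (Pts.map (shift p.1) nu.tPow)⁻¹) *
        (Pts.map (shift p.1) Q)⁻¹ *
        (Pts.map (shift p.1) mu.tPow * (Pts.map (shift 0) mu.tPow)⁻¹) := by
      rw [e1, Pts.map_mul, Pts.map_mul, Pts.map_inv, Pts.map_inv]
      group
    rw [e2]
    refine mul_mem (mul_mem (nu.isCochar.shift_div_mem _ _) (inv_mem ?_))
      (mu.isCochar.shift_div_mem _ _)
    rw [hQ, hmap]
    refine map_aeval_mem _ ?_ q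
    refine ⟨1, Polynomial.X - Polynomial.C p.1, Polynomial.X_sub_C_ne_zero _, by simp, ?_⟩
    rw [map_one, one_div, zpow_neg_one]
    rfl

end HeckeP1
end

/-! ### Integrality of weights, `𝔰𝔩₂`-triples, and conclusion -/

namespace HeckeP1

variable {A : Type u} [CommRing A] [HopfAlgebra ℂ A]

/-- The pairing of a coweight with a weight occurring in the Lie algebra is an integer. -/
theorem Coweight.exists_int {H : LieSubalgebra ℂ (LieAlg A)} (mu : Coweight H) {x : LieAlg A}
    (hx0 : x ≠ 0) {c : ℂ} (hc : ⁅mu.val.1, x⁆ = c • x) : ∃ k : ℤ, (k : ℂ) = c :=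
  mu.isCochar.exists_int (w := LieAlg.fn x) (by rw [← LieAlg.fn_lie, hc, map_smul])
    fun h => hx0 (LieAlg.fn_injective (h.trans (map_zero _).symm))

/-- A root vector is part of an `𝔰𝔩₂`-triple containing the coroot. -/
theorem exists_isSl2Triple_of_mem_rootSpace [Algebra.FiniteType ℂ A]
    [LieAlgebra.IsSimple ℂ (LieAlg A)] (H : LieSubalgebra ℂ (LieAlg A)) [H.IsCartanSubalgebra]
    (α : H.root) {x : LieAlg A} (hx : x ∈ LieAlgebra.rootSpace H α.1) (hx0 : x ≠ 0) :
    ∃ y : LieAlg A, y ∈ LieAlgebra.rootSpace H (-α.1) ∧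
      IsSl2Triple (LieAlgebra.IsKilling.coroot α.1 : H).1 x y := by
  have hα : α.1.IsNonZero := (Finset.mem_filter.1 α.2).2
  obtain ⟨h, e, f, ht, he, hf⟩ := LieAlgebra.IsKilling.exists_isSl2Triple_of_weight_isNonZero hα
  have hh := ht.h_eq_coroot hα he hf
  obtain ⟨c, hc⟩ := (finrank_eq_one_iff_of_nonzero' ⟨e, he⟩ (by simpa using ht.e_ne_zero)).1
    (LieAlgebra.IsKilling.finrank_rootSpace_eq_one α.1 hα) ⟨x, hx⟩
  have hc : c • e = x := congrArg Subtype.val hc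
  have hc0 : c ≠ 0 := by
    rintro rfl
    exact hx0 (by rw [← hc, zero_smul])
  -- The root space is a line, so `x = c e`; rescaling `f` inversely preserves `[e, f] = h`.
  refine ⟨c⁻¹ • f, Submodule.smul_mem _ _ hf, ?_⟩
  rw [← hh, ← hc]
  refine ⟨ht.h_ne_zero, ?_, ?_, ?_⟩
  · rw [smul_lie, lie_smul, smul_smul, mul_inv_cancel₀ hc0, one_smul, ht.lie_e_f]
  · rw [lie_smul, ht.lie_h_e_nsmul, smul_comm]
  · rw [lie_smul, ht.lie_h_f_nsmul, smul_neg, smul_comm]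

end HeckeP1

/-- `G = Spec A` is a connected affine algebraic group over `ℂ` with simple Lie algebra, `H` a Cartan
subalgebra of its Lie algebra and `b` a base of the root system (fixing the positive roots). -/
theorem proposition5p2p2 {A : Type u} [CommRing A] [HopfAlgebra ℂ A] [Algebra.FiniteType ℂ A]
    [ConnectedSpace (PrimeSpectrum A)] [LieAlgebra.IsSimple ℂ (HeckeP1.LieAlg A)]
    (H : LieSubalgebra ℂ (HeckeP1.LieAlg A)) [H.IsCartanSubalgebra]
    (b : (LieAlgebra.IsKilling.rootSystem H).Base)
    (lam mu : HeckeP1.Coweight H) (hlam : lam.IsDominant b) (hmu : mu.IsDominant b)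
    (α : H.root) (hα : b.IsPos α) (j : ℕ) (hj : (j : ℂ) < α.1 lam.val)
    (x : HeckeP1.LieAlg A) (hx : x ∈ LieAlgebra.rootSpace H α.1) (hx0 : x ≠ 0) :
    (∃ nu : HeckeP1.Coweight H,
      nu.val = mu.val + lam.val - ((j : ℂ) + α.1 mu.val) • LieAlgebra.IsKilling.coroot α.1 ∧
      ∀ p : HeckeP1.TangentPt, Nonempty (HeckeP1.GBundle.Iso
        (HeckeP1.heckeBundle mu p
          (HeckeP1.expT x (HeckeP1.locNilp_of_mem_rootSpace H α hx) j * lam.tPow))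
        (HeckeP1.bundle nu))) ∧
    ∀ p q : HeckeP1.TangentPt, Nonempty (HeckeP1.GBundle.Iso
      (HeckeP1.heckeBundle mu p
        (HeckeP1.expT x (HeckeP1.locNilp_of_mem_rootSpace H α hx) j * lam.tPow))
      (HeckeP1.heckeBundle mu q
        (HeckeP1.expT x (HeckeP1.locNilp_of_mem_rootSpace H α hx) j * lam.tPow))) := by
  obtain ⟨y, hy, ht⟩ := HeckeP1.exists_isSl2Triple_of_mem_rootSpace H α hx hx0
  have hwx : ∀ v : H, ⁅v.1, x⁆ = α.1 v • x := fun v =>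
    LieAlgebra.IsKilling.lie_eq_smul_of_mem_rootSpace hx v
  have hwy : ∀ v : H, ⁅v.1, y⁆ = -(α.1 v • y) := fun v => by
    have hy' : y ∈ LieAlgebra.rootSpace H (-α.1 : LieModule.Weight ℂ H (HeckeP1.LieAlg A)) := by
      simpa using hy
    have := LieAlgebra.IsKilling.lie_eq_smul_of_mem_rootSpace hy' v
    simpa using this
  obtain ⟨l, hl⟩ := lam.exists_int hx0 (hwx lam.val)
  obtain ⟨m, hm⟩ := mu.exists_int hx0 (hwx mu.val)
  -- Dominance of `μ` makes `j + m` a natural number, as required for `q` to be polynomial in `t⁻¹`.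
  have hm0 : 0 ≤ m := by
    have := hmu α hα
    rw [← hm] at this
    exact_mod_cast this
  lift m to ℕ using hm0
  have hjl : (j : ℤ) < l := by
    rw [← hl] at hj
    exact_mod_cast hj
  lift l to ℕ using by omega
  -- The relation `[h, y] = -2y` has nonzero eigenvalue, which forces local nilpotency and makes
  -- `exp(s y)` available.
  have hlocy : HeckeP1.LocNilp y := HeckeP1.locNilp_of_lie_eq_smul (c := -2) (by norm_num)
    (by rw [ht.lie_lie_smul_f ℂ, neg_smul])
  rw [Int.cast_natCast] at hl hm
  obtain ⟨nu, k, q, hnu, e⟩ := HeckeP1.exists_coweight_factorization lam mu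
    (HeckeP1.locNilp_of_mem_rootSpace H α hx) hlocy ht (l := l) (m := m) (j := j)
    (by exact_mod_cast hjl) (by rw [hl]; exact hwy _) (by rw [hm]; exact hwx _)
    (by rw [hm]; exact hwy _)
  have iso := HeckeP1.nonempty_iso_of_factorization e
  refine ⟨⟨nu, by rw [hnu, hm], iso⟩, fun p p' => ?_⟩
  obtain ⟨e1⟩ := iso p
  obtain ⟨e2⟩ := iso p'
  -- Both modifications are compared through the bundle of the same `ν`.
  exact ⟨e1.trans e2.symm⟩
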